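/- For real $\nu$ and $z\in\mathbb C$ with $z\neq 0$, $|\arg z|<\pi$, let $$I_\nu(z)=\Big(\frac z2\Big)^{\nu}\sum_{n=0}^\infty\frac{(z^2/4)^n}{n!\,\Gamma(n+\nu+1)}$$ (principal value of the power, and $1/\Gamma=0$ at the poles of $\Gamma$) be the modified Bessel function of the first kind, and let $K_\nu$ be the modified Bessel function of the second kind, that is, $$K_\nu(z)=\frac{\pi}{2}\,\frac{I_{-\nu}(z)-I_\nu(z)}{\sin(\nu\pi)}\quad(\nu\notin\mathbb Z),\qquad K_n(z)=\lim_{\mu\to n,\ \mu\ne n}K_\mu(z)\quad(n\in\mathbb Z).$$ Suppose that $-\frac12\le\nu\le\frac12$ and that $x\in\mathbb C$, $x\neq0$, $|\arg x|<\pi$. Then the function $$f(t)=e^{2t\operatorname{Re}x}\,|K_\nu(tx)|^2$$ is strictly completely monotone on $(0,\infty)$; that is, $f$ is infinitely differentiable on $(0,\infty)$ and $(-1)^n f^{(n)}(t)>0$ for all $t>0$ and all $n=0,1,2,\dots$. -/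

import Mathlib

open scoped Topology ContDiff

/-- The modified Bessel function of the first kind of real order `ν` (principal branch),
`I_ν(z) = (z/2)^ν ∑_{n ≥ 0} (z²/4)^n / (n! Γ(n + ν + 1))`.
At a pole of `Γ` the term is `0`, which is the usual convention `1/Γ = 0` there
(in Mathlib `Γ` takes the value `0` at its poles, and `a / 0 = 0`). -/
noncomputable def besselI (ν : ℝ) (z : ℂ) : ℂ :=
  (z / 2) ^ (ν : ℂ) *
    ∑' n : ℕ, (z ^ 2 / 4) ^ n / ((n.factorial : ℂ) * Complex.Gamma ((n : ℂ) + (ν : ℂ) + 1))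

/-- The quotient `(π/2) (I_{-ν}(z) - I_ν(z)) / sin(νπ)`. -/
noncomputable def besselKQuotient (ν : ℝ) (z : ℂ) : ℂ :=
  (Real.pi / 2 : ℂ) * (besselI (-ν) z - besselI ν z) / (Real.sin (ν * Real.pi) : ℂ)

open Classical in
/-- The modified Bessel function of the second kind (Macdonald function) `K_ν(z)` of real order
`ν` (principal branch): `K_ν = (π/2) (I_{-ν} - I_ν) / sin(νπ)` if `ν` is not an integer, and
`K_n = lim_{μ → n, μ ≠ n} K_μ` if `n` is an integer. -/
noncomputable def besselK (ν : ℝ) (z : ℂ) : ℂ :=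
  if ∃ n : ℤ, ν = (n : ℝ) then Filter.limUnder (𝓝[≠] ν) (fun μ : ℝ => besselKQuotient μ z)
  else besselKQuotient ν z

/-- `f` is strictly completely monotone on `(0, ∞)`: it is smooth there, and
`(-1)^n f^{(n)}(t) > 0` for all `t > 0` and all `n = 0, 1, 2, …`. -/
def StrictlyCompletelyMonotone (f : ℝ → ℝ) : Prop :=
  ContDiffOn ℝ ∞ f (Set.Ioi 0) ∧
    ∀ n : ℕ, ∀ t : ℝ, 0 < t → 0 < (-1 : ℝ) ^ n * iteratedDeriv n f t

/-! The function is the Laplace transform of a strictly positive density on `(0, ∞)`;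
differentiating under the integral sign then gives every sign at once
(`strictlyCompletelyMonotone_laplace`).

For `|ν| < 1/2`, `K_ν(z)` equals `(π/(2z))^{1/2} e^{-z} / Γ(ν+1/2)` times `∫₀^∞ e^{-s} s^{ν-1/2} (1
+ s/(2z))^{ν-1/2} ds` on the slit plane (`besselK_eq_macdonald`). On the positive axis this comes
from a uniqueness statement for the modified Bessel equation (`besselEntire.eq_of_system`): a
solution is fixed by its coefficients of `1` and `x^{2μ}` at zero. The identity theorem extends it
to the slit plane, and a limit in the order gives `ν = 0`.

The decisive point is that `K` is even in `ν`, so `|K_ν|²` may be written as `K_ν` times the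
conjugate of `K_{-ν}`. Put `z = tx`, `ζ = 1/(2x)`. The product becomes a product of two Laplace
transforms in `t`, hence the transform of a convolution of kernels with exponents `ν - 1/2` and `-ν
- 1/2`. These add up to `-1`, so the convolution at `ρ` is scale invariant: the substitution `τ =
ρv/(1+v)` followed by the rotation `v = qw`, `q = 1 + ρ conj ζ`, turns it into `∫₀^∞ w^{ν-1/2} (1 +
w|q|²)^{ν-1/2} (1 + w)^{-ν-1/2} dw`, which is visibly positive (`macdonaldKernel_convolution`,
`rotatedDensity_eq`). The prefactors contribute `e^{-2t Re x}` and `1/t`, which cancel.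

At `ν = ±1/2` the function is `π/(2t|x|)`, the transform of a constant. -/

open Filter MeasureTheory Set

/-! ### Holomorphy of parameter integrals -/

/-- An integral of functions depending holomorphically on a parameter is holomorphic as soon as
the integrand is locally dominated (uniformly in the parameter) by an integrable function. -/
theorem differentiableOn_integral_of_dominated {α : Type*} [MeasurableSpace α] {μ : Measure α}
    {U : Set ℂ} {F : ℂ → α → ℂ}
    (hF_meas : ∀ z ∈ U, AEStronglyMeasurable (F z) μ)
    (hF_diff : ∀ᵐ a ∂μ, DifferentiableOn ℂ (fun z => F z a) U)
    (hF_bound : ∀ z₀ ∈ U, ∃ r > 0, ∃ B : α → ℝ, Integrable B μ ∧ Metric.ball z₀ r ⊆ U ∧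
      ∀ᵐ a ∂μ, ∀ z ∈ Metric.ball z₀ r, ‖F z a‖ ≤ B a) :
    DifferentiableOn ℂ (fun z => ∫ a, F z a ∂μ) U := by
  intro z₀ hz₀
  obtain ⟨r, hr, B, hB, hU, hbd⟩ := hF_bound z₀ hz₀
  have hz₀r : z₀ ∈ Metric.ball z₀ r := Metric.mem_ball_self hr
  have hderiv : ∀ᵐ a ∂μ, HasDerivAt (fun z => F z a) (deriv (fun z => F z a) z₀) z₀ := by
    filter_upwards [hF_diff] with a ha
    exact ((ha.mono hU).differentiableAt (Metric.isOpen_ball.mem_nhds hz₀r)).hasDerivAt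
  -- Measurability of `F z` is given only for each fixed `z`, so the derivative is obtained as a
  -- limit of difference quotients along a sequence tending to `z₀`.
  have hmeas' : AEStronglyMeasurable (fun a => deriv (fun z => F z a) z₀) μ := by
    have hseq : ∀ n : ℕ, z₀ + ((r / 2 * (1 / ((n : ℝ) + 1)) : ℝ) : ℂ) ∈ Metric.ball z₀ r := by
      intro n
      rw [Metric.mem_ball, dist_eq_norm, add_sub_cancel_left, Complex.norm_real, Real.norm_eq_abs,
        abs_of_pos (by positivity)]
      have : (1 : ℝ) / ((n : ℝ) + 1) ≤ 1 := by
        rw [div_le_one (by positivity)]; linarith [n.cast_nonneg (α := ℝ)]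
      nlinarith
    refine aestronglyMeasurable_of_tendsto_ae atTop
      (f := fun (n : ℕ) a => (((r / 2 * (1 / ((n : ℝ) + 1)) : ℝ) : ℂ))⁻¹ •
        (F (z₀ + ((r / 2 * (1 / ((n : ℝ) + 1)) : ℝ) : ℂ)) a - F z₀ a)) ?_ ?_
    · intro n
      exact ((hF_meas _ (hU (hseq n))).sub (hF_meas _ hz₀)).const_smul
        (((r / 2 * (1 / ((n : ℝ) + 1)) : ℝ) : ℂ))⁻¹
    · filter_upwards [hderiv] with a ha
      refine ha.tendsto_slope_zero.comp ?_
      refine tendsto_nhdsWithin_iff.2 ⟨?_, Eventually.of_forall fun n => ?_⟩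
      · have h1 : Tendsto (fun n : ℕ => r / 2 * (1 / ((n : ℝ) + 1))) atTop (𝓝 (r / 2 * 0)) :=
          tendsto_one_div_add_atTop_nhds_zero_nat.const_mul _
        rw [mul_zero] at h1
        exact (Complex.continuous_ofReal.tendsto' 0 0 Complex.ofReal_zero).comp h1
      · have : (0 : ℝ) < r / 2 * (1 / ((n : ℝ) + 1)) := by positivity
        exact Complex.ofReal_ne_zero.2 this.ne'
  -- The bound `B a / (r / 2)` is Cauchy's estimate on circles of radius `r / 2`; centred in the
  -- half ball, they stay where `B` dominates.
  refine HasDerivAt.differentiableAt (hasDerivAt_integral_of_dominated_loc_of_deriv_le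
    (s := Metric.ball z₀ (r / 2)) (F' := fun z a => deriv (fun z => F z a) z)
    (bound := fun a => B a / (r / 2)) (Metric.ball_mem_nhds _ (by positivity)) ?_ ?_ hmeas' ?_
    (hB.div_const _) ?_).2 |>.differentiableWithinAt
  · filter_upwards [Metric.ball_mem_nhds z₀ hr] with z hz using hF_meas z (hU hz)
  · refine Integrable.mono' hB (hF_meas _ hz₀) ?_
    filter_upwards [hbd] with a ha using ha _ hz₀r
  · filter_upwards [hbd, hF_diff] with a ha hd z hz
    have hsub : ∀ w, dist w z ≤ r / 2 → w ∈ Metric.ball z₀ r := by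
      intro w hw
      rw [Metric.mem_ball] at hz ⊢
      linarith [dist_triangle w z z₀]
    refine Complex.norm_deriv_le_of_forall_mem_sphere_norm_le (by positivity) ?_ ?_
    · refine DifferentiableOn.diffContOnCl_ball (U := Metric.ball z₀ r) (hd.mono hU) ?_
      intro w hw
      exact hsub w hw
    · intro w hw
      exact ha w (hsub w (le_of_eq hw))
  · filter_upwards [hF_diff] with a hd z hz
    have hz' : z ∈ Metric.ball z₀ r := Metric.ball_subset_ball (by linarith) hz
    exact ((hd.mono hU).differentiableAt (Metric.isOpen_ball.mem_nhds hz')).hasDerivAt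

/-! ### Lower bounds and powers on the slit plane -/

namespace Complex

theorem inv_mem_slitPlane_of_mem {z : ℂ} (hz : z ∈ slitPlane) : z⁻¹ ∈ slitPlane := by
  have h0 : 0 < normSq z := normSq_pos.2 (slitPlane_ne_zero hz)
  rcases hz with h | h
  · left; rw [inv_re]; positivity
  · right; rw [inv_im]; exact div_ne_zero (neg_ne_zero.2 h) h0.ne'

/-- The difference of the two sides is exactly `(‖z‖ - re z) / 2 * (1 - s‖z‖)²`. -/
theorem norm_sq_add_ofReal_mul_ge {z : ℂ} {s : ℝ} :
    (1 + s * ‖z‖) ^ 2 * ((‖z‖ + z.re) / 2) ≤ ‖1 + s * z‖ ^ 2 * ‖z‖ := by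
  have h1 : ‖1 + (s : ℂ) * z‖ ^ 2 = 1 + 2 * s * z.re + s ^ 2 * ‖z‖ ^ 2 := by
    rw [← normSq_eq_norm_sq, ← normSq_eq_norm_sq, normSq_apply, normSq_apply]
    simp
    ring
  have h2 : z.re ≤ ‖z‖ := re_le_norm z
  rw [h1]
  nlinarith [mul_nonneg (sub_nonneg.2 h2) (sq_nonneg (1 - s * ‖z‖))]

theorem norm_add_re_pos {z : ℂ} (hz : z ∈ slitPlane) : 0 < ‖z‖ + z.re := by
  rcases hz with h | h
  · have := norm_nonneg z; linarith
  · have := abs_re_lt_norm.2 h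
    have := neg_abs_le z.re
    linarith

/-- On a neighbourhood of a point of the slit plane, `‖1 + s z‖` is bounded below by a multiple
of `1 + s`, uniformly in `s ≥ 0`. -/
theorem exists_ball_le_norm_one_add_mul {z₀ : ℂ} (hz₀ : z₀ ∈ slitPlane) :
    ∃ r > 0, ∃ m > 0, m ≤ 1 ∧ ∀ z ∈ Metric.ball z₀ r, z ∈ slitPlane ∧
      ∀ s : ℝ, 0 ≤ s → m * (1 + s) ≤ ‖1 + s * z‖ := by
  have hn0 : 0 < ‖z₀‖ := norm_pos_iff.2 (slitPlane_ne_zero hz₀)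
  have hp0 := norm_add_re_pos hz₀
  -- The square root is `cos (arg z / 2)`, the loss in comparing `‖1 + sz‖` with `1 + s‖z‖`; the
  -- minimum is the loss in passing from there to `1 + s`. Continuity of the product makes the bound
  -- locally uniform.
  set κ : ℂ → ℝ := fun z => Real.sqrt ((‖z‖ + z.re) / (2 * ‖z‖)) * min 1 ‖z‖ with hκ
  have hκ0 : 0 < κ z₀ := by
    simp only [hκ]
    have : 0 < min 1 ‖z₀‖ := lt_min one_pos hn0
    positivity
  have hcont : ContinuousAt κ z₀ := by
    refine ContinuousAt.mul (Real.continuous_sqrt.continuousAt.comp (ContinuousAt.div ?_ ?_ ?_)) ?_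
    · exact (continuous_norm.add continuous_re).continuousAt
    · exact (continuous_const.mul continuous_norm).continuousAt
    · positivity
    · exact (continuous_const.min continuous_norm).continuousAt
  have hev : ∀ᶠ z in 𝓝 z₀, κ z₀ / 2 < κ z ∧ z ∈ slitPlane :=
    (hcont.eventually (lt_mem_nhds (half_lt_self hκ0))).and (isOpen_slitPlane.mem_nhds hz₀)
  obtain ⟨r, hr, hball⟩ := Metric.eventually_nhds_iff_ball.1 hev
  refine ⟨r, hr, min 1 (κ z₀ / 2), lt_min one_pos (by positivity), min_le_left _ _,
    fun z hz => ⟨(hball z hz).2, fun s hs => ?_⟩⟩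
  have hzs := (hball z hz).2
  have hn : 0 < ‖z‖ := norm_pos_iff.2 (slitPlane_ne_zero hzs)
  have hp := norm_add_re_pos hzs
  have h1 : Real.sqrt ((‖z‖ + z.re) / (2 * ‖z‖)) * (1 + s * ‖z‖) ≤ ‖1 + s * z‖ := by
    refine le_of_sq_le_sq ?_ (norm_nonneg _)
    rw [mul_pow, Real.sq_sqrt (by positivity)]
    have := norm_sq_add_ofReal_mul_ge (z := z) (s := s)
    rw [div_mul_eq_mul_div, div_le_iff₀ (by positivity)]
    linarith
  have h2 : min 1 ‖z‖ * (1 + s) ≤ 1 + s * ‖z‖ := by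
    have := min_le_left 1 ‖z‖
    have := min_le_right 1 ‖z‖
    nlinarith
  calc min 1 (κ z₀ / 2) * (1 + s) ≤ κ z * (1 + s) := by
        gcongr
        exact (min_le_right _ _).trans (hball z hz).1.le
    _ = Real.sqrt ((‖z‖ + z.re) / (2 * ‖z‖)) * (min 1 ‖z‖ * (1 + s)) := by simp only [hκ]; ring
    _ ≤ Real.sqrt ((‖z‖ + z.re) / (2 * ‖z‖)) * (1 + s * ‖z‖) := by gcongr
    _ ≤ _ := h1

/-- On a neighbourhood of a point of the slit plane, `‖z + s‖` is bounded below by a multiple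
of `1 + s`, uniformly in `s ≥ 0`. -/
theorem exists_ball_le_norm_add {z₀ : ℂ} (hz₀ : z₀ ∈ slitPlane) :
    ∃ r > 0, ∃ m > 0, m ≤ 1 ∧ ∀ z ∈ Metric.ball z₀ r, z ∈ slitPlane ∧
      ∀ s : ℝ, 0 ≤ s → m * (1 + s) ≤ ‖z + s‖ := by
  have hn0 : 0 < ‖z₀‖ := norm_pos_iff.2 (slitPlane_ne_zero hz₀)
  obtain ⟨r, hr, m, hm, hm1, hb⟩ := exists_ball_le_norm_one_add_mul (inv_mem_slitPlane_of_mem hz₀)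
  have hev : ∀ᶠ z in 𝓝 z₀, z⁻¹ ∈ Metric.ball z₀⁻¹ r ∧ ‖z₀‖ / 2 < ‖z‖ :=
    ((continuousAt_inv₀ (slitPlane_ne_zero hz₀)).eventually (Metric.ball_mem_nhds _ hr)).and
      (continuous_norm.continuousAt.eventually (lt_mem_nhds (half_lt_self hn0)))
  obtain ⟨r', hr', hball⟩ := Metric.eventually_nhds_iff_ball.1 hev
  refine ⟨r', hr', min 1 (‖z₀‖ / 2 * m), lt_min one_pos (by positivity), min_le_left _ _,
    fun z hz => ?_⟩
  obtain ⟨h1, h2⟩ := hb _ (hball z hz).1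
  have hzs : z ∈ slitPlane := by
    simpa using inv_mem_slitPlane_of_mem h1
  refine ⟨hzs, fun s hs => ?_⟩
  have hz0 : z ≠ 0 := slitPlane_ne_zero hzs
  have heq : z + s = z * (1 + s * z⁻¹) := by field_simp
  rw [heq, norm_mul]
  calc min 1 (‖z₀‖ / 2 * m) * (1 + s) ≤ ‖z₀‖ / 2 * m * (1 + s) := by
        gcongr; exact min_le_right _ _
    _ = ‖z₀‖ / 2 * (m * (1 + s)) := by ring
    _ ≤ ‖z‖ * ‖1 + s * z⁻¹‖ := by
        gcongr
        · exact (hball z hz).2.le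
        · exact h2 s hs

theorem one_add_ofReal_mul_mem_slitPlane {z : ℂ} (hz : z ∈ slitPlane) {s : ℝ} (hs : 0 ≤ s) :
    1 + s * z ∈ slitPlane := by
  rcases hs.eq_or_lt with rfl | hs
  · simp
  rcases hz with h | h
  · left
    simp only [add_re, one_re, re_ofReal_mul]
    positivity
  · right
    simpa using ⟨hs.ne', h⟩

theorem add_ofReal_mem_slitPlane {z : ℂ} (hz : z ∈ slitPlane) {s : ℝ} (hs : 0 ≤ s) :
    z + s ∈ slitPlane := by
  rcases hz with h | h
  · left; simp only [add_re, ofReal_re]; positivity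
  · right; simpa using h

theorem norm_cpow_ofReal_le {z : ℂ} {a c : ℝ} (ha : a ≤ 0) (hc : 0 < c) (h : c ≤ ‖z‖) :
    ‖z ^ (a : ℂ)‖ ≤ c ^ a := by
  have hz : z ≠ 0 := norm_pos_iff.1 (hc.trans_le h)
  rw [norm_cpow_real]
  exact Real.rpow_le_rpow_of_nonpos hc h ha

theorem ofReal_mul_cpow {r : ℝ} (hr : 0 < r) {z : ℂ} (hz : z ≠ 0) (w : ℂ) :
    ((r : ℂ) * z) ^ w = (r : ℂ) ^ w * z ^ w := by
  have hr' : (r : ℂ) ≠ 0 := ofReal_ne_zero.2 hr.ne'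
  rw [cpow_def_of_ne_zero (mul_ne_zero hr' hz), cpow_def_of_ne_zero hr', cpow_def_of_ne_zero hz,
    log_ofReal_mul hr hz, ofReal_log hr.le, add_mul, exp_add]

end Complex

/-- Two holomorphic functions on the slit plane which agree on the positive reals are equal. -/
theorem eqOn_slitPlane_of_eqOn_pos {f g : ℂ → ℂ} (hf : DifferentiableOn ℂ f Complex.slitPlane)
    (hg : DifferentiableOn ℂ g Complex.slitPlane) (h : ∀ x : ℝ, 0 < x → f x = g x) :
    EqOn f g Complex.slitPlane := by
  refine AnalyticOnNhd.eqOn_of_preconnected_of_frequently_eq (z₀ := 1)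
    (hf.analyticOnNhd Complex.isOpen_slitPlane) (hg.analyticOnNhd Complex.isOpen_slitPlane) ?_
    Complex.one_mem_slitPlane ?_
  · exact (Complex.starConvex_one_slitPlane.isPathConnected
      Complex.one_mem_slitPlane).isConnected.isPreconnected
  · have hseq : Tendsto (fun n : ℕ => ((1 + 1 / ((n : ℝ) + 1) : ℝ) : ℂ)) atTop (𝓝[≠] 1) := by
      refine tendsto_nhdsWithin_iff.2 ⟨?_, Eventually.of_forall fun n => ?_⟩
      · have h1 : Tendsto (fun n : ℕ => 1 + 1 / ((n : ℝ) + 1)) atTop (𝓝 (1 + 0)) :=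
          tendsto_one_div_add_atTop_nhds_zero_nat.const_add _
        rw [add_zero] at h1
        exact (Complex.continuous_ofReal.tendsto' 1 1 Complex.ofReal_one).comp h1
      · have : (0 : ℝ) < 1 / ((n : ℝ) + 1) := by positivity
        simp only [mem_compl_iff, mem_singleton_iff]
        rw [← Complex.ofReal_one, Complex.ofReal_inj]
        linarith
    refine hseq.frequently (Eventually.frequently (Eventually.of_forall fun n => ?_))
    exact h _ (by positivity)

/-! ### The power series of the Bessel functions -/

/-- The entire function `∑ wⁿ / (n! Γ(n + b))`, so that
`I_ν(z) = (z/2)^ν besselEntire (ν + 1) (z²/4)`. -/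
noncomputable def besselEntire (b : ℝ) (w : ℂ) : ℂ :=
  ∑' n : ℕ, w ^ n / ((n.factorial : ℂ) * (Real.Gamma (n + b) : ℂ))

theorem besselI_eq_besselEntire (ν : ℝ) (z : ℂ) :
    besselI ν z = (z / 2) ^ (ν : ℂ) * besselEntire (ν + 1) (z ^ 2 / 4) := by
  unfold besselI besselEntire
  congr 2 with n
  rw [← Complex.Gamma_ofReal]
  push_cast
  rw [add_assoc]

namespace besselEntire

/-- From index `1` on the argument is at least `1`, so `Γ(s + 1) = s Γ(s)` makes the sequence
nondecreasing and only the first two values compete. The bound lets the exponential series dominate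
`besselEntire`. -/
theorem exists_le_Gamma {b : ℝ} (hb : 0 < b) : ∃ c > 0, ∀ n : ℕ, c ≤ Real.Gamma (n + b) := by
  refine ⟨min (Real.Gamma b) (Real.Gamma (b + 1)), lt_min (Real.Gamma_pos_of_pos hb)
    (Real.Gamma_pos_of_pos (by linarith)), fun n => ?_⟩
  rcases n with _ | n
  · simp
  · refine (min_le_right _ _).trans ?_
    induction n with
    | zero => simp [add_comm]
    | succ n ih =>
      have h : ((n + 1 + 1 : ℕ) : ℝ) + b = ((n + 1 : ℕ) + b) + 1 := by push_cast; ring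
      have hpos : (1 : ℝ) ≤ (n + 1 : ℕ) + b := by
        push_cast; linarith [n.cast_nonneg (α := ℝ)]
      rw [h, Real.Gamma_add_one (s := ((n + 1 : ℕ) : ℝ) + b) (by linarith)]
      have := Real.Gamma_pos_of_pos (by linarith : 0 < ((n + 1 : ℕ) : ℝ) + b)
      nlinarith

theorem norm_term_le {c b : ℝ} (hc : 0 < c) (h : ∀ n : ℕ, c ≤ Real.Gamma (n + b)) (w : ℂ) (n : ℕ) :
    ‖w ^ n / ((n.factorial : ℂ) * (Real.Gamma (n + b) : ℂ))‖ ≤ ‖w‖ ^ n / n.factorial * c⁻¹ := by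
  have h0 : 0 < Real.Gamma (n + b) := hc.trans_le (h n)
  rw [norm_div, norm_mul, norm_pow, Complex.norm_real, Complex.norm_natCast, Real.norm_eq_abs,
    abs_of_pos h0, ← div_div, div_eq_mul_inv _ (Real.Gamma _)]
  gcongr
  exact h n

theorem summable {b : ℝ} (hb : 0 < b) (w : ℂ) :
    Summable fun n : ℕ => w ^ n / ((n.factorial : ℂ) * (Real.Gamma (n + b) : ℂ)) := by
  obtain ⟨c, hc, h⟩ := exists_le_Gamma hb
  exact Summable.of_norm_bounded ((Real.summable_pow_div_factorial ‖w‖).mul_right c⁻¹)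
    (norm_term_le hc h w)

/-- Termwise differentiation: `n / n! = 1 / (n-1)!`, and reindexing moves the unit shift into `b`.
-/
theorem hasDerivAt {b : ℝ} (hb : 0 < b) (w : ℂ) :
    HasDerivAt (besselEntire b) (besselEntire (b + 1) w) w := by
  obtain ⟨c, hc, h⟩ := exists_le_Gamma (b := b + 1) (by linarith)
  have hterm : ∀ (n : ℕ) (y : ℂ),
      (n + 1 : ℕ) * y ^ n / (((n + 1).factorial : ℂ) * (Real.Gamma ((n + 1 : ℕ) + b) : ℂ)) =
        y ^ n / ((n.factorial : ℂ) * (Real.Gamma (n + (b + 1)) : ℂ)) := by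
    intro n y
    have h1 : ((n + 1 : ℕ) : ℝ) + b = n + (b + 1) := by push_cast; ring
    rw [h1, Nat.factorial_succ, Nat.cast_mul, mul_assoc,
      mul_div_mul_left _ _ (Nat.cast_ne_zero.2 n.succ_ne_zero)]
  -- The truncated subtraction `0 - 1 = 0` is harmless: the derivative of the term `n = 0` carries
  -- the factor `0`.
  have hu : Summable fun n : ℕ => (‖w‖ + 1) ^ (n - 1) / ((n - 1).factorial : ℝ) * c⁻¹ := by
    refine (summable_nat_add_iff 1).1 ?_
    simpa using (Real.summable_pow_div_factorial (‖w‖ + 1)).mul_right c⁻¹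
  have hw : w ∈ Metric.ball (0 : ℂ) (‖w‖ + 1) := by simp
  have key := hasDerivAt_tsum_of_isPreconnected (𝕜 := ℂ)
    (g := fun (n : ℕ) y => y ^ n / ((n.factorial : ℂ) * (Real.Gamma (n + b) : ℂ)))
    (g' := fun (n : ℕ) y => n * y ^ (n - 1) / ((n.factorial : ℂ) * (Real.Gamma (n + b) : ℂ)))
    hu (Metric.isOpen_ball (x := (0 : ℂ)) (ε := ‖w‖ + 1)) (convex_ball _ _).isPreconnected
    (fun n y _ => (hasDerivAt_pow n y).div_const _) (fun n y hy => ?_) hw (summable hb w) hw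
  · have hs : Summable fun n : ℕ =>
        (n * w ^ (n - 1) / ((n.factorial : ℂ) * (Real.Gamma (n + b) : ℂ))) := by
      refine (summable_nat_add_iff 1).1 ?_
      simp only [add_tsub_cancel_right]
      simp_rw [hterm]
      exact summable (by linarith) w
    rw [hs.tsum_eq_zero_add] at key
    simp only [add_tsub_cancel_right, hterm] at key
    simpa [besselEntire] using! key
  · rcases n with _ | n
    · simp; positivity
    · have hy' : ‖y‖ ≤ ‖w‖ + 1 := by simpa using (Metric.mem_ball.1 hy).le
      simp only [add_tsub_cancel_right, hterm]
      refine (norm_term_le hc h y n).trans ?_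
      gcongr

theorem differentiable {b : ℝ} (hb : 0 < b) : Differentiable ℂ (besselEntire b) :=
  fun w => (hasDerivAt hb w).differentiableAt

/-- Write `1/Γ(n+b) = (n+b)/Γ(n+b+1)` and split the numerator: `b` gives the first sum, while `n`
cancels against `n!` and shifts the index. Combined with `hasDerivAt`, this is the modified Bessel
equation. -/
theorem recurrence {b : ℝ} (hb : 0 < b) (w : ℂ) :
    besselEntire b w = b * besselEntire (b + 1) w + w * besselEntire (b + 2) w := by
  have hs := summable (b := b + 1) (by linarith) w
  have hs2 := summable (b := b + 2) (by linarith) w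
  have hterm : ∀ n : ℕ, w ^ n / ((n.factorial : ℂ) * (Real.Gamma (n + b) : ℂ)) =
      b * (w ^ n / ((n.factorial : ℂ) * (Real.Gamma (n + (b + 1)) : ℂ))) +
      n * (w ^ n / ((n.factorial : ℂ) * (Real.Gamma (n + (b + 1)) : ℂ))) := by
    intro n
    have h0 : 0 < (n : ℝ) + b := by positivity
    rw [← add_assoc, Real.Gamma_add_one h0.ne']
    have h1 : (Real.Gamma (n + b) : ℂ) ≠ 0 := Complex.ofReal_ne_zero.2 (Real.Gamma_pos_of_pos h0).ne'
    have h2 : (n : ℂ) + b ≠ 0 := by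
      have := Complex.ofReal_ne_zero.2 h0.ne'
      simpa using this
    have h3 : (n.factorial : ℂ) ≠ 0 := Nat.cast_ne_zero.2 n.factorial_ne_zero
    push_cast
    field_simp
    ring
  have hshift : ∀ n : ℕ, ((n + 1 : ℕ) : ℂ) *
      (w ^ (n + 1) / (((n + 1).factorial : ℂ) * (Real.Gamma ((n + 1 : ℕ) + (b + 1)) : ℂ))) =
      w * (w ^ n / ((n.factorial : ℂ) * (Real.Gamma (n + (b + 2)) : ℂ))) := by
    intro n
    have h1 : ((n + 1 : ℕ) : ℝ) + (b + 1) = n + (b + 2) := by push_cast; ring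
    have h3 : ((n + 1 : ℕ) : ℂ) ≠ 0 := Nat.cast_ne_zero.2 n.succ_ne_zero
    rw [h1, Nat.factorial_succ, Nat.cast_mul, mul_assoc, mul_div_assoc', mul_div_mul_left _ _ h3,
      pow_succ]
    ring
  have hs3 : Summable fun n : ℕ =>
      n * (w ^ n / ((n.factorial : ℂ) * (Real.Gamma (n + (b + 1)) : ℂ))) := by
    refine (summable_nat_add_iff 1).1 ?_
    simp_rw [hshift]
    exact hs2.mul_left w
  unfold besselEntire
  simp_rw [hterm]
  rw [(hs.mul_left _).tsum_add hs3, tsum_mul_left, hs3.tsum_eq_zero_add]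
  simp_rw [hshift]
  rw [tsum_mul_left]
  simp

theorem zero (b : ℝ) : besselEntire b 0 = (Real.Gamma b : ℂ)⁻¹ := by
  unfold besselEntire
  rw [tsum_eq_single 0 (fun n hn => by simp [hn])]
  simp

/-- The restriction of `besselEntire` to the real line. -/
noncomputable def real (b x : ℝ) : ℝ :=
  ∑' n : ℕ, x ^ n / ((n.factorial : ℝ) * Real.Gamma (n + b))

theorem ofReal (b x : ℝ) : besselEntire b x = (real b x : ℂ) := by
  unfold besselEntire real
  rw [Complex.ofReal_tsum]
  push_cast
  rfl

theorem real_summable {b : ℝ} (hb : 0 < b) (x : ℝ) :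
    Summable fun n : ℕ => x ^ n / ((n.factorial : ℝ) * Real.Gamma (n + b)) := by
  have := summable hb (x : ℂ)
  rw [← Complex.summable_ofReal]
  refine this.congr fun n => ?_
  push_cast
  rfl

theorem real_pos {b : ℝ} (hb : 0 < b) {x : ℝ} (hx : 0 ≤ x) : 0 < real b x := by
  have hG : ∀ n : ℕ, 0 < Real.Gamma (n + b) := fun n => Real.Gamma_pos_of_pos (by positivity)
  refine (real_summable hb x).tsum_pos (fun n => ?_) 0 ?_
  · have := hG n
    positivity
  · have := hG 0
    simpa using this

theorem real_hasDerivAt {b : ℝ} (hb : 0 < b) (x : ℝ) :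
    HasDerivAt (real b) (real (b + 1) x) x := by
  have h := (hasDerivAt hb (x : ℂ)).real_of_complex
  simpa [ofReal] using h

theorem real_recurrence {b : ℝ} (hb : 0 < b) (x : ℝ) :
    real b x = b * real (b + 1) x + x * real (b + 2) x := by
  have := recurrence hb (x : ℂ)
  simp only [ofReal] at this
  exact_mod_cast this

theorem real_zero (b : ℝ) : real b 0 = (Real.Gamma b)⁻¹ := by
  have := zero b
  rw [← Complex.ofReal_zero, ofReal] at this
  exact_mod_cast this

end besselEntire

/-! ### The modified Bessel equation as a first-order system -/

theorem eq_of_hasDerivAt_zero_Ioi {g : ℝ → ℝ} (h : ∀ x, 0 < x → HasDerivAt g 0 x) {x : ℝ}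
    (hx : 0 < x) : g x = g 1 :=
  isOpen_Ioi.is_const_of_deriv_eq_zero isPreconnected_Ioi
    (fun y hy => (h y hy).differentiableAt.differentiableWithinAt)
    (fun y hy => (h y hy).deriv) (mem_Ioi.2 hx) (mem_Ioi.2 one_pos)

namespace besselEntire

theorem real_continuous {b : ℝ} (hb : 0 < b) : Continuous (real b) :=
  continuous_iff_continuousAt.2 fun x => (real_hasDerivAt hb x).continuousAt

theorem hasDerivAt_real_sq {b : ℝ} (hb : 0 < b) (x : ℝ) :
    HasDerivAt (fun x => real b (x ^ 2 / 4)) (real (b + 1) (x ^ 2 / 4) * (x / 2)) x := by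
  have h : HasDerivAt (fun x : ℝ => x ^ 2 / 4) (x / 2) x := by
    have := (hasDerivAt_pow 2 x).div_const 4
    convert! this using 1
    ring
  exact (real_hasDerivAt hb _).comp x h

variable {μ : ℝ}

/-- The functions `x^μ I_{∓μ}(x)` are, up to constants, `real (1 - μ) (x²/4)` and `x^{2μ} real (1 +
μ) (x²/4)`. Both solve `(x^{1-2μ} y')' = x^{1-2μ} y`; with `p = x^{1-2μ} y'` this is the system used
below, and it has a Wronskian free of weights. -/
theorem hasDerivAt_first {x : ℝ} (hμ1 : μ < 1) (hx : 0 < x) :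
    HasDerivAt (fun x => real (1 - μ) (x ^ 2 / 4))
      (x ^ (2 * μ - 1) * (x ^ (2 - 2 * μ) / 2 * real (2 - μ) (x ^ 2 / 4))) x := by
  convert! hasDerivAt_real_sq (b := 1 - μ) (by linarith) x using 1
  have h : x ^ (2 * μ - 1) * x ^ (2 - 2 * μ) = x := by
    rw [← Real.rpow_add hx, show 2 * μ - 1 + (2 - 2 * μ) = 1 by ring, Real.rpow_one]
  rw [show 1 - μ + 1 = 2 - μ by ring]
  linear_combination real (2 - μ) (x ^ 2 / 4) / 2 * h

theorem hasDerivAt_first' {x : ℝ} (hμ1 : μ < 1) (hx : 0 < x) :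
    HasDerivAt (fun x => x ^ (2 - 2 * μ) / 2 * real (2 - μ) (x ^ 2 / 4))
      (x ^ (1 - 2 * μ) * real (1 - μ) (x ^ 2 / 4)) x := by
  have h1 := (Real.hasDerivAt_rpow_const (x := x) (p := 2 - 2 * μ) (Or.inl hx.ne')).div_const 2
  convert! h1.mul (hasDerivAt_real_sq (b := 2 - μ) (by linarith) x) using 1
  have h : x ^ (2 - 2 * μ) = x ^ (1 - 2 * μ) * x := by
    rw [← Real.rpow_add_one hx.ne']; congr 1; ring
  rw [real_recurrence (b := 1 - μ) (by linarith), h, show 1 - μ + 1 = 2 - μ by ring,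
    show 1 - μ + 2 = 2 - μ + 1 by ring, show 2 - 2 * μ - 1 = 1 - 2 * μ by ring]
  ring

theorem hasDerivAt_second {x : ℝ} (hμ0 : 0 < μ) (hx : 0 < x) :
    HasDerivAt (fun x => x ^ (2 * μ) * real (1 + μ) (x ^ 2 / 4))
      (x ^ (2 * μ - 1) * (2 * real μ (x ^ 2 / 4))) x := by
  have h1 := Real.hasDerivAt_rpow_const (x := x) (p := 2 * μ) (Or.inl hx.ne')
  convert! h1.mul (hasDerivAt_real_sq (b := 1 + μ) (by linarith) x) using 1
  have h : x ^ (2 * μ) = x ^ (2 * μ - 1) * x := by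
    rw [← Real.rpow_add_one hx.ne']; congr 1; ring
  rw [real_recurrence hμ0, h, show μ + 1 = 1 + μ by ring, show 1 + μ + 1 = μ + 2 by ring]
  ring

theorem hasDerivAt_second' {x : ℝ} (hμ0 : 0 < μ) (hx : 0 < x) :
    HasDerivAt (fun x => 2 * real μ (x ^ 2 / 4))
      (x ^ (1 - 2 * μ) * (x ^ (2 * μ) * real (1 + μ) (x ^ 2 / 4))) x := by
  convert! (hasDerivAt_real_sq hμ0 x).const_mul 2 using 1
  have h : x ^ (1 - 2 * μ) * x ^ (2 * μ) = x := by
    rw [← Real.rpow_add hx, sub_add_cancel, Real.rpow_one]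
  rw [← mul_assoc, h, add_comm 1 μ]
  ring

theorem tendsto_real_sq {b : ℝ} (hb : 0 < b) :
    Tendsto (fun x : ℝ => real b (x ^ 2 / 4)) (𝓝[>] 0) (𝓝 (Real.Gamma b)⁻¹) := by
  have hc : Continuous fun x : ℝ => real b (x ^ 2 / 4) := (real_continuous hb).comp (by fun_prop)
  have := hc.tendsto 0
  rw [show (0 : ℝ) ^ 2 / 4 = 0 by norm_num, real_zero] at this
  exact this.mono_left nhdsWithin_le_nhds

theorem tendsto_rpow_zero {a : ℝ} (ha : 0 < a) :
    Tendsto (fun x : ℝ => x ^ a) (𝓝[>] 0) (𝓝 0) := by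
  have := (Real.continuous_rpow_const ha.le).tendsto (0 : ℝ)
  rw [Real.zero_rpow ha.ne'] at this
  exact this.mono_left nhdsWithin_le_nhds

/-- Two solutions of `y' = x^{2μ-1} p`, `p' = x^{1-2μ} y` have constant Wronskian. -/
theorem wronskian_const {y p z q : ℝ → ℝ}
    (hy : ∀ x, 0 < x → HasDerivAt y (x ^ (2 * μ - 1) * p x) x)
    (hp : ∀ x, 0 < x → HasDerivAt p (x ^ (1 - 2 * μ) * y x) x)
    (hz : ∀ x, 0 < x → HasDerivAt z (x ^ (2 * μ - 1) * q x) x)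
    (hq : ∀ x, 0 < x → HasDerivAt q (x ^ (1 - 2 * μ) * z x) x) {x : ℝ} (hx : 0 < x) :
    y x * q x - z x * p x = y 1 * q 1 - z 1 * p 1 := by
  refine eq_of_hasDerivAt_zero_Ioi (g := fun x => y x * q x - z x * p x) (fun x hx => ?_) hx
  convert! ((hy x hx).mul (hq x hx)).sub ((hz x hx).mul (hp x hx)) using 1
  ring

/-- The solution of the modified Bessel equation, written as the first-order system
`y' = x^{2μ-1} p`, `p' = x^{1-2μ} y`, with behaviour `A + B x^{2μ} + o(x^{2μ})` at zero. -/
theorem eq_of_system (hμ0 : 0 < μ) (hμ1 : μ < 1) {y p : ℝ → ℝ} {A B : ℝ}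
    (hy : ∀ x, 0 < x → HasDerivAt y (x ^ (2 * μ - 1) * p x) x)
    (hp : ∀ x, 0 < x → HasDerivAt p (x ^ (1 - 2 * μ) * y x) x)
    (hB : Tendsto (fun x => (y x - A) / x ^ (2 * μ)) (𝓝[>] 0) (𝓝 B)) {x : ℝ} (hx : 0 < x) :
    y x = A * Real.Gamma (1 - μ) * real (1 - μ) (x ^ 2 / 4) +
      B * Real.Gamma (1 + μ) * (x ^ (2 * μ) * real (1 + μ) (x ^ 2 / 4)) := by
  have hG1 : 0 < Real.Gamma (1 - μ) := Real.Gamma_pos_of_pos (by linarith)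
  have hG2 : 0 < Real.Gamma (1 + μ) := Real.Gamma_pos_of_pos (by linarith)
  have hG0 : 0 < Real.Gamma μ := Real.Gamma_pos_of_pos hμ0
  set y₁ : ℝ → ℝ := fun x => real (1 - μ) (x ^ 2 / 4) with hy₁
  set y₂ : ℝ → ℝ := fun x => x ^ (2 * μ) * real (1 + μ) (x ^ 2 / 4) with hy₂
  set p₁ : ℝ → ℝ := fun x => x ^ (2 - 2 * μ) / 2 * real (2 - μ) (x ^ 2 / 4) with hp₁
  set p₂ : ℝ → ℝ := fun x => 2 * real μ (x ^ 2 / 4) with hp₂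
  have dy₁ : ∀ x, 0 < x → HasDerivAt y₁ (x ^ (2 * μ - 1) * p₁ x) x :=
    fun x hx => hasDerivAt_first hμ1 hx
  have dp₁ : ∀ x, 0 < x → HasDerivAt p₁ (x ^ (1 - 2 * μ) * y₁ x) x :=
    fun x hx => hasDerivAt_first' hμ1 hx
  have dy₂ : ∀ x, 0 < x → HasDerivAt y₂ (x ^ (2 * μ - 1) * p₂ x) x :=
    fun x hx => hasDerivAt_second hμ0 hx
  have dp₂ : ∀ x, 0 < x → HasDerivAt p₂ (x ^ (1 - 2 * μ) * y₂ x) x :=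
    fun x hx => hasDerivAt_second' hμ0 hx
  have y₁pos : ∀ x, 0 < y₁ x := fun x => real_pos (by linarith) (by positivity)
  have ty₁ : Tendsto y₁ (𝓝[>] 0) (𝓝 (Real.Gamma (1 - μ))⁻¹) := tendsto_real_sq (by linarith)
  have tR : Tendsto (fun x : ℝ => real (1 + μ) (x ^ 2 / 4)) (𝓝[>] 0)
    (𝓝 (Real.Gamma (1 + μ))⁻¹) := tendsto_real_sq (by linarith)
  have ty₂ : Tendsto y₂ (𝓝[>] 0) (𝓝 0) := by
    simpa using (tendsto_rpow_zero (a := 2 * μ) (by linarith)).mul tR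
  have tp₁ : Tendsto p₁ (𝓝[>] 0) (𝓝 0) := by
    simpa using ((tendsto_rpow_zero (a := 2 - 2 * μ) (by linarith)).div_const 2).mul
      (tendsto_real_sq (b := 2 - μ) (by linarith))
  have tp₂ : Tendsto p₂ (𝓝[>] 0) (𝓝 (2 * (Real.Gamma μ)⁻¹)) := (tendsto_real_sq hμ0).const_mul 2
  obtain ⟨C, hC⟩ : ∃ C, ∀ x, 0 < x → y₁ x * p x - y x * p₁ x = C :=
    ⟨_, fun x hx => wronskian_const dy₁ dp₁ hy hp hx⟩
  obtain ⟨D, hD⟩ : ∃ D, ∀ x, 0 < x → y₁ x * p₂ x - y₂ x * p₁ x = D :=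
    ⟨_, fun x hx => wronskian_const dy₁ dp₁ dy₂ dp₂ hx⟩
  -- The constant `D` is read off at zero, where it tends to `2 / (Γ(1-μ) Γ(μ))`.
  have hD0 : D ≠ 0 := by
    have h1 : Tendsto (fun x => y₁ x * p₂ x - y₂ x * p₁ x) (𝓝[>] 0)
      (𝓝 ((Real.Gamma (1 - μ))⁻¹ * (2 * (Real.Gamma μ)⁻¹) - 0 * 0)) :=
      (ty₁.mul tp₂).sub (ty₂.mul tp₁)
    have h2 : Tendsto (fun x => y₁ x * p₂ x - y₂ x * p₁ x) (𝓝[>] 0) (𝓝 D) :=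
      tendsto_const_nhds.congr' (by filter_upwards [self_mem_nhdsWithin] with x hx using (hD x hx).symm)
    rw [tendsto_nhds_unique h2 h1]
    have : 0 < (Real.Gamma (1 - μ))⁻¹ * (2 * (Real.Gamma μ)⁻¹) := by positivity
    simpa using this.ne'
  -- Reduction of order: the derivatives of `y / y₁` and `y₂ / y₁` are `x^{2μ-1} C / y₁²` and
  -- `x^{2μ-1} D / y₁²`, hence proportional.
  obtain ⟨k₁, hk₁⟩ : ∃ k, ∀ x, 0 < x → y x / y₁ x - C / D * (y₂ x / y₁ x) = k := by
    refine ⟨_, fun x hx => eq_of_hasDerivAt_zero_Ioi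
      (g := fun x => y x / y₁ x - C / D * (y₂ x / y₁ x)) (fun x hx => ?_) hx⟩
    have h1 := (hy x hx).div (dy₁ x hx) (y₁pos x).ne'
    have h2 := ((dy₂ x hx).div (dy₁ x hx) (y₁pos x).ne').const_mul (C / D)
    convert! h1.sub h2 using 1
    have h3 := (y₁pos x).ne'
    field_simp
    linear_combination (x ^ (2 * μ - 1) * C) * hD x hx - (x ^ (2 * μ - 1) * D) * hC x hx
  have hrep : ∀ x, 0 < x → y x = k₁ * y₁ x + C / D * y₂ x := by
    intro x hx
    have h3 := (y₁pos x).ne'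
    rw [← hk₁ x hx]
    field_simp
    ring
  have hA : k₁ * (Real.Gamma (1 - μ))⁻¹ = A := by
    have h1 : Tendsto y (𝓝[>] 0) (𝓝 (k₁ * (Real.Gamma (1 - μ))⁻¹ + C / D * 0)) :=
      ((ty₁.const_mul k₁).add (ty₂.const_mul (C / D))).congr'
        (by filter_upwards [self_mem_nhdsWithin] with x hx using (hrep x hx).symm)
    have h2 : Tendsto y (𝓝[>] 0) (𝓝 (B * 0 + A)) := by
      refine ((hB.mul (tendsto_rpow_zero (a := 2 * μ) (by linarith))).add_const A).congr' ?_
      filter_upwards [self_mem_nhdsWithin] with x hx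
      rw [div_mul_cancel₀ _ (Real.rpow_pos_of_pos hx _).ne', sub_add_cancel]
    simpa using tendsto_nhds_unique h1 h2
  -- The deviation of `y₁` from its value at zero is of order `x²`, which is `o(x^{2μ})` because `μ
  -- < 1`; so only `y₂` contributes to `B`.
  have hBv : C / D * (Real.Gamma (1 + μ))⁻¹ = B := by
    have hslope : Tendsto (fun x : ℝ => (real (1 - μ) (x ^ 2 / 4) - real (1 - μ) 0) / (x ^ 2 / 4))
        (𝓝[>] 0) (𝓝 (real (1 - μ + 1) 0)) := by
      have h := (real_hasDerivAt (b := 1 - μ) (by linarith) 0).tendsto_slope_zero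
      have h' : Tendsto (fun x : ℝ => x ^ 2 / 4) (𝓝[>] 0) (𝓝[≠] 0) := by
        refine tendsto_nhdsWithin_iff.2 ⟨?_, ?_⟩
        · exact (Continuous.tendsto' (by fun_prop) 0 0 (by norm_num)).mono_left nhdsWithin_le_nhds
        · filter_upwards [self_mem_nhdsWithin] with x hx
          have : 0 < x := hx
          have : x ^ 2 / 4 ≠ 0 := by positivity
          exact this
      refine (h.comp h').congr fun x => ?_
      simp [div_eq_inv_mul]
    have h1 : Tendsto (fun x => (y x - A) / x ^ (2 * μ)) (𝓝[>] 0)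
        (𝓝 (k₁ * (real (1 - μ + 1) 0 * (0 / 4)) + C / D * (Real.Gamma (1 + μ))⁻¹)) := by
      refine (((hslope.mul ((tendsto_rpow_zero (a := 2 - 2 * μ)
        (by linarith)).div_const 4)).const_mul k₁).add (tR.const_mul (C / D))).congr' ?_
      filter_upwards [self_mem_nhdsWithin] with x hx
      have hx' : 0 < x := hx
      rw [hrep x hx', ← hA, real_zero]
      have h4 : x ^ (2 - 2 * μ) = x ^ 2 / x ^ (2 * μ) := by
        rw [Real.rpow_sub hx', Real.rpow_two]
      have h5 := (Real.rpow_pos_of_pos hx' (2 * μ)).ne'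
      simp only [hy₁, hy₂]
      rw [h4]
      field_simp
      ring
    simpa using tendsto_nhds_unique h1 hB
  rw [hrep x hx, ← hA, ← hBv]
  have e1 : k₁ * (Real.Gamma (1 - μ))⁻¹ * Real.Gamma (1 - μ) = k₁ := by field_simp
  have e2 : C / D * (Real.Gamma (1 + μ))⁻¹ * Real.Gamma (1 + μ) = C / D := by field_simp
  rw [e1, e2]

end besselEntire

/-! ### Laplace transforms of positive densities -/

section Laplace

variable {α : Type*} [MeasurableSpace α] {ν : Measure α} {X g : α → ℝ}

theorem integral_withDensity_ofReal (hg : AEMeasurable g ν) (hg0 : ∀ᵐ a ∂ν, 0 ≤ g a) (F : α → ℝ) :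
    ∫ a, F a ∂ν.withDensity (fun a => ENNReal.ofReal (g a)) = ∫ a, F a * g a ∂ν := by
  rw [integral_withDensity_eq_integral_toReal_smul₀ hg.ennreal_ofReal
    (Eventually.of_forall fun _ => ENNReal.ofReal_lt_top)]
  refine integral_congr_ae ?_
  filter_upwards [hg0] with a ha
  rw [ENNReal.toReal_ofReal ha, smul_eq_mul, mul_comm]

theorem integrable_withDensity_ofReal_iff (hg : AEMeasurable g ν) (hg0 : ∀ᵐ a ∂ν, 0 ≤ g a)
    (F : α → ℝ) :
    Integrable F (ν.withDensity fun a => ENNReal.ofReal (g a)) ↔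
      Integrable (fun a => F a * g a) ν := by
  rw [integrable_withDensity_iff_integrable_smul₀' hg.ennreal_ofReal
    (Eventually.of_forall fun _ => ENNReal.ofReal_lt_top)]
  refine integrable_congr ?_
  filter_upwards [hg0] with a ha
  rw [ENNReal.toReal_ofReal ha, smul_eq_mul, mul_comm]

/-- Viewing the transform as the moment generating function of `X` under the measure with density
`g`, integrability for all `t > 0` puts each such `t` in the interior of the domain, where
smoothness and differentiation under the integral are available. -/
theorem mem_interior_integrableExpSet_withDensity (hg : AEMeasurable g ν)
    (hg0 : ∀ᵐ a ∂ν, 0 ≤ g a)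
    (hint : ∀ t, 0 < t → Integrable (fun a => Real.exp (t * X a) * g a) ν) {t : ℝ} (ht : 0 < t) :
    t ∈ interior (ProbabilityTheory.integrableExpSet X
      (ν.withDensity fun a => ENNReal.ofReal (g a))) := by
  refine mem_interior.2 ⟨Ioi 0, fun s hs => ?_, isOpen_Ioi, ht⟩
  exact (integrable_withDensity_ofReal_iff hg hg0 _).2 (hint s hs)

theorem mgf_withDensity (hg : AEMeasurable g ν) (hg0 : ∀ᵐ a ∂ν, 0 ≤ g a) :
    ProbabilityTheory.mgf X (ν.withDensity fun a => ENNReal.ofReal (g a)) =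
      fun t => ∫ a, Real.exp (t * X a) * g a ∂ν := by
  ext t
  exact integral_withDensity_ofReal hg hg0 _

theorem integrable_pow_mul_exp_mul (hg : AEMeasurable g ν) (hg0 : ∀ᵐ a ∂ν, 0 ≤ g a)
    (hint : ∀ t, 0 < t → Integrable (fun a => Real.exp (t * X a) * g a) ν) (n : ℕ) {t : ℝ}
    (ht : 0 < t) : Integrable (fun a => X a ^ n * Real.exp (t * X a) * g a) ν :=
  (integrable_withDensity_ofReal_iff hg hg0 _).1
    (ProbabilityTheory.integrable_pow_mul_exp_of_mem_interior_integrableExpSet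
      (mem_interior_integrableExpSet_withDensity hg hg0 hint ht) n)

theorem hasDerivAt_integral_pow_mul_exp_mul (hg : AEMeasurable g ν) (hg0 : ∀ᵐ a ∂ν, 0 ≤ g a)
    (hint : ∀ t, 0 < t → Integrable (fun a => Real.exp (t * X a) * g a) ν) (n : ℕ) {t : ℝ}
    (ht : 0 < t) :
    HasDerivAt (fun t => ∫ a, X a ^ n * Real.exp (t * X a) * g a ∂ν)
      (∫ a, X a ^ (n + 1) * Real.exp (t * X a) * g a ∂ν) t := by
  have := ProbabilityTheory.hasDerivAt_integral_pow_mul_exp_real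
    (mem_interior_integrableExpSet_withDensity hg hg0 hint ht) n
  simpa only [integral_withDensity_ofReal hg hg0] using this

theorem iteratedDeriv_integral_exp_mul (hg : AEMeasurable g ν) (hg0 : ∀ᵐ a ∂ν, 0 ≤ g a)
    (hint : ∀ t, 0 < t → Integrable (fun a => Real.exp (t * X a) * g a) ν) (n : ℕ) {t : ℝ}
    (ht : 0 < t) :
    iteratedDeriv n (fun t => ∫ a, Real.exp (t * X a) * g a ∂ν) t =
      ∫ a, X a ^ n * Real.exp (t * X a) * g a ∂ν := by
  rw [← mgf_withDensity hg hg0, ProbabilityTheory.iteratedDeriv_mgf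
    (mem_interior_integrableExpSet_withDensity hg hg0 hint ht) n,
    integral_withDensity_ofReal hg hg0]

theorem contDiffOn_integral_exp_mul (hg : AEMeasurable g ν) (hg0 : ∀ᵐ a ∂ν, 0 ≤ g a)
    (hint : ∀ t, 0 < t → Integrable (fun a => Real.exp (t * X a) * g a) ν) :
    ContDiffOn ℝ ∞ (fun t => ∫ a, Real.exp (t * X a) * g a ∂ν) (Ioi 0) := by
  intro t ht
  rw [← mgf_withDensity hg hg0]
  exact (ProbabilityTheory.analyticAt_mgf
    (mem_interior_integrableExpSet_withDensity hg hg0 hint ht)).contDiffAt.contDiffWithinAt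

end Laplace

/-- The Laplace transform of a positive function on `(0, ∞)` is strictly completely monotone. -/
theorem strictlyCompletelyMonotone_laplace {g : ℝ → ℝ} (hg : ∀ u, 0 < u → 0 < g u)
    (hint : ∀ t, 0 < t → IntegrableOn (fun u => Real.exp (-(t * u)) * g u) (Ioi 0)) :
    StrictlyCompletelyMonotone fun t => ∫ u in Ioi 0, Real.exp (-(t * u)) * g u := by
  have hint' : ∀ t, 0 < t → IntegrableOn (fun u => Real.exp (t * (-u)) * g u) (Ioi 0) := by
    simpa only [mul_neg] using hint
  have hg0 : ∀ᵐ u ∂volume.restrict (Ioi (0 : ℝ)), 0 ≤ g u :=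
    (ae_restrict_iff' measurableSet_Ioi).2 (Eventually.of_forall fun u hu => (hg u hu).le)
  -- Measurability of `g` is recovered from integrability at `t = 1` by multiplying back by `e^u`.
  have hgm : AEMeasurable g (volume.restrict (Ioi 0)) := by
    have h1 : AEMeasurable (fun u => Real.exp (1 * u) * (Real.exp (1 * (-u)) * g u))
        (volume.restrict (Ioi 0)) :=
      (by fun_prop : Measurable fun u : ℝ => Real.exp (1 * u)).aemeasurable.mul
        (hint' 1 one_pos).aestronglyMeasurable.aemeasurable
    refine h1.congr (Eventually.of_forall fun u => ?_)
    simp only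
    rw [← mul_assoc, ← Real.exp_add]
    simp
  have heq : (fun t => ∫ u in Ioi 0, Real.exp (-(t * u)) * g u) =
      fun t => ∫ u in Ioi 0, Real.exp (t * (-u)) * g u := by simp only [mul_neg]
  rw [heq]
  refine ⟨contDiffOn_integral_exp_mul hgm hg0 hint', fun n t ht => ?_⟩
  rw [iteratedDeriv_integral_exp_mul hgm hg0 hint' n ht, ← integral_const_mul]
  have hi := (integrable_pow_mul_exp_mul hgm hg0 hint' n ht).const_mul ((-1) ^ n)
  have hform : ∀ u : ℝ, (-1) ^ n * ((-u) ^ n * Real.exp (t * -u) * g u) =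
      u ^ n * Real.exp (t * -u) * g u := by
    intro u
    rw [neg_pow u n, ← mul_assoc, ← mul_assoc, ← mul_assoc, ← mul_pow]
    simp
  simp only [hform] at hi ⊢
  refine (setIntegral_pos_iff_support_of_nonneg_ae ?_ hi).2 ?_
  · filter_upwards [self_mem_ae_restrict (measurableSet_Ioi (a := (0 : ℝ)))] with u hu
    have := hg u hu
    have : 0 < u := hu
    simp only [Pi.zero_apply]
    positivity
  · have : Ioi (0 : ℝ) ⊆
        (Function.support fun u => u ^ n * Real.exp (t * -u) * g u) ∩ Ioi 0 := by
      intro u hu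
      refine ⟨?_, hu⟩
      have := hg u hu
      have : 0 < u := hu
      rw [Function.mem_support]
      positivity
    refine lt_of_lt_of_le ?_ (measure_mono this)
    simp

/-! ### Gamma and beta type integrals -/

theorem integrableOn_rpow_mul_exp_neg {s b : ℝ} (hs : -1 < s) (hb : 0 < b) :
    IntegrableOn (fun x : ℝ => x ^ s * Real.exp (-(b * x))) (Ioi 0) := by
  simpa using integrableOn_rpow_mul_exp_neg_mul_rpow hs one_pos hb

theorem integrableOn_rpow_mul_one_add_rpow {a b : ℝ} (ha : -1 < a) (hb : b ≤ 0) (hab : a + b < -1) :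
    IntegrableOn (fun v : ℝ => v ^ a * (1 + v) ^ b) (Ioi 0) := by
  have hm : Measurable fun v : ℝ => v ^ a * (1 + v) ^ b := by fun_prop
  rw [← Ioc_union_Ioi_eq_Ioi (zero_le_one' ℝ), integrableOn_union]
  constructor
  · have h : IntegrableOn (fun v : ℝ => v ^ a) (Ioc 0 1) :=
      (intervalIntegrable_iff_integrableOn_Ioc_of_le zero_le_one).1
        (intervalIntegral.intervalIntegrable_rpow' ha)
    refine Integrable.mono' h hm.aestronglyMeasurable ?_
    filter_upwards [self_mem_ae_restrict measurableSet_Ioc] with v hv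
    have hv0 : 0 < v := hv.1
    rw [Real.norm_of_nonneg (by positivity)]
    exact mul_le_of_le_one_right (by positivity)
      (Real.rpow_le_one_of_one_le_of_nonpos (by linarith) hb)
  · refine Integrable.mono' (integrableOn_Ioi_rpow_of_lt hab one_pos) hm.aestronglyMeasurable ?_
    filter_upwards [self_mem_ae_restrict measurableSet_Ioi] with v hv
    have hv0 : 0 < v := one_pos.trans hv
    rw [Real.norm_of_nonneg (by positivity), Real.rpow_add hv0]
    gcongr ?_ * ?_
    exact Real.rpow_le_rpow_of_nonpos hv0 (by linarith) hb

theorem integral_Ioi_swap_of_nonneg {f : ℝ → ℝ → ℝ} (hm : Measurable (Function.uncurry f))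
    (h0 : ∀ u, 0 < u → ∀ r, 0 < r → 0 ≤ f u r) (h1 : ∀ u, 0 < u → IntegrableOn (f u) (Ioi 0))
    (h2 : IntegrableOn (fun u => ∫ r in Ioi 0, f u r) (Ioi 0)) :
    ∫ u in Ioi 0, ∫ r in Ioi 0, f u r = ∫ r in Ioi 0, ∫ u in Ioi 0, f u r := by
  refine integral_integral_swap ((integrable_prod_iff hm.aestronglyMeasurable).2 ⟨?_, ?_⟩)
  · filter_upwards [self_mem_ae_restrict measurableSet_Ioi] with u hu using h1 u hu
  · refine h2.congr ?_
    filter_upwards [self_mem_ae_restrict measurableSet_Ioi] with u hu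
    refine setIntegral_congr_fun measurableSet_Ioi fun r hr => ?_
    exact (Real.norm_of_nonneg (h0 u hu r hr)).symm

/-- The function `(u (u + 2))^a` has integral `Γ(a+1) Γ(-2a-1) 2^{2a+1} / Γ(-a)` over `(0, ∞)`. -/
theorem integral_mul_add_two_rpow {a : ℝ} (ha1 : -1 < a) (ha2 : a < -(1 / 2)) :
    ∫ u in Ioi (0 : ℝ), (u * (u + 2)) ^ a =
      Real.Gamma (a + 1) * Real.Gamma (-2 * a - 1) * 2 ^ (2 * a + 1) / Real.Gamma (-a) := by
  have hG : 0 < Real.Gamma (-a) := Real.Gamma_pos_of_pos (by linarith)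
  rw [eq_div_iff hG.ne', ← integral_mul_const]
  -- The factor `(u + 2)^a` is expanded as a Gamma integral in `r`; after exchanging the integrals
  -- both are Gamma integrals.
  have hin : ∀ u : ℝ, 0 < u → ∫ r in Ioi (0 : ℝ), u ^ a * (r ^ (-a - 1) * Real.exp (-((u + 2) * r)))
      = (u * (u + 2)) ^ a * Real.Gamma (-a) := by
    intro u hu
    rw [integral_const_mul, Real.integral_rpow_mul_exp_neg_mul_Ioi (by linarith) (by linarith),
      Real.mul_rpow hu.le (by linarith), one_div, Real.inv_rpow (by linarith),
      Real.rpow_neg (by linarith), inv_inv, mul_assoc]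
  have hout : ∀ r : ℝ, 0 < r → ∫ u in Ioi (0 : ℝ), u ^ a * (r ^ (-a - 1) * Real.exp (-((u + 2) * r)))
      = Real.Gamma (a + 1) * (r ^ (-2 * a - 1 - 1) * Real.exp (-(2 * r))) := by
    intro r hr
    have h := Real.integral_rpow_mul_exp_neg_mul_Ioi (a := a + 1) (r := r) (by linarith) hr
    have h' : ∀ u : ℝ, u ^ a * (r ^ (-a - 1) * Real.exp (-((u + 2) * r))) =
        (r ^ (-a - 1) * Real.exp (-(2 * r))) * (u ^ (a + 1 - 1) * Real.exp (-(r * u))) := by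
      intro u
      rw [add_sub_cancel_right, show -((u + 2) * r) = -(2 * r) + -(r * u) by ring, Real.exp_add]
      ring
    simp_rw [h']
    rw [integral_const_mul, h, one_div, Real.inv_rpow hr.le, ← Real.rpow_neg hr.le,
      show -2 * a - 1 - 1 = (-a - 1) + -(a + 1) by ring, Real.rpow_add hr]
    ring
  have hswap := integral_Ioi_swap_of_nonneg
    (f := fun u r => u ^ a * (r ^ (-a - 1) * Real.exp (-((u + 2) * r)))) ?_ ?_ ?_ ?_
  · rw [setIntegral_congr_fun measurableSet_Ioi (fun u hu => hin u hu),
      setIntegral_congr_fun measurableSet_Ioi (fun r hr => hout r hr)] at hswap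
    rw [hswap, integral_const_mul, Real.integral_rpow_mul_exp_neg_mul_Ioi (by linarith) two_pos,
      one_div, Real.inv_rpow two_pos.le, ← Real.rpow_neg two_pos.le]
    ring_nf
  · simp only [Function.uncurry_def]
    fun_prop
  · intro u hu r hr
    positivity
  · intro u hu
    exact (integrableOn_rpow_mul_exp_neg (s := -a - 1) (by linarith)
      (by linarith : 0 < u + 2)).const_mul _
  · refine IntegrableOn.congr_fun ?_ (fun u hu => (hin u hu).symm) measurableSet_Ioi
    refine Integrable.mul_const ?_ _
    refine Integrable.mono' (integrableOn_rpow_mul_one_add_rpow ha1 (b := a) (by linarith)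
      (by linarith)) (by fun_prop : Measurable fun u : ℝ => (u * (u + 2)) ^ a).aestronglyMeasurable ?_
    filter_upwards [self_mem_ae_restrict measurableSet_Ioi] with u hu
    have hu0 : 0 < u := hu
    rw [Real.norm_of_nonneg (by positivity), Real.mul_rpow hu0.le (by linarith)]
    gcongr ?_ * ?_
    exact Real.rpow_le_rpow_of_nonpos (by linarith) (by linarith) (by linarith)

/-- The Cauchy–Saalschütz integral for `Γ` on `(-1, 0)`. -/
theorem integral_exp_neg_sub_one_mul_rpow {c : ℝ} (hc1 : -1 < c) (hc0 : c < 0)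
    (hint : IntegrableOn (fun v : ℝ => (Real.exp (-v) - 1) * v ^ (c - 1)) (Ioi 0)) :
    ∫ v in Ioi (0 : ℝ), (Real.exp (-v) - 1) * v ^ (c - 1) = Real.Gamma c := by
  have hc : c ≠ 0 := hc0.ne
  have hu : ∀ v ∈ Ioi (0 : ℝ), HasDerivAt (fun v : ℝ => Real.exp (-v) - 1) (-Real.exp (-v)) v := by
    intro v _
    simpa using! ((hasDerivAt_id v).neg.exp).sub_const 1
  have hv : ∀ v ∈ Ioi (0 : ℝ), HasDerivAt (fun v : ℝ => v ^ c / c) (v ^ (c - 1)) v := by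
    intro v hv
    have := (Real.hasDerivAt_rpow_const (x := v) (p := c) (Or.inl (ne_of_gt hv))).div_const c
    convert! this using 1
    field_simp
  have hu'v : IntegrableOn (fun v : ℝ => -Real.exp (-v) * (v ^ c / c)) (Ioi 0) := by
    refine IntegrableOn.congr_fun ((integrableOn_rpow_mul_exp_neg hc1 one_pos).mul_const (-c⁻¹))
      (fun v _ => ?_) measurableSet_Ioi
    simp only [one_mul]
    ring
  have hzero : Tendsto ((fun v : ℝ => Real.exp (-v) - 1) * fun v : ℝ => v ^ c / c) (𝓝[>] 0)
      (𝓝 0) := by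
    have h1 : HasDerivAt (fun v : ℝ => Real.exp (-v)) (-Real.exp (-0)) 0 := by
      simpa using! (hasDerivAt_id (0 : ℝ)).neg.exp
    have h2 := (h1.tendsto_slope_zero).mono_left
      (nhdsWithin_mono (0 : ℝ) (fun x (hx : 0 < x) => ne_of_gt hx) : 𝓝[>] (0 : ℝ) ≤ 𝓝[≠] 0)
    have h3 := h2.mul ((besselEntire.tendsto_rpow_zero (a := c + 1) (by linarith)).div_const c)
    rw [zero_div, mul_zero] at h3
    refine h3.congr' ?_
    filter_upwards [self_mem_nhdsWithin] with v hv
    have hv0 : 0 < v := hv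
    simp only [zero_add, neg_zero, Real.exp_zero, smul_eq_mul, Pi.mul_apply]
    rw [Real.rpow_add_one hv0.ne']
    field_simp
  have hinfty : Tendsto ((fun v : ℝ => Real.exp (-v) - 1) * fun v : ℝ => v ^ c / c) atTop
      (𝓝 0) := by
    have h1 : Tendsto (fun v : ℝ => Real.exp (-v) - 1) atTop (𝓝 (0 - 1)) :=
      (Real.tendsto_exp_neg_atTop_nhds_zero).sub_const 1
    have h2 : Tendsto (fun v : ℝ => v ^ c / c) atTop (𝓝 (0 / c)) := by
      have := tendsto_rpow_neg_atTop (y := -c) (by linarith)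
      rw [neg_neg] at this
      exact this.div_const c
    simpa using! h1.mul h2
  -- Integration by parts raises the exponent into the range of Euler's integral. The boundary terms
  -- vanish at `0` since `e^{-v} - 1 = O(v)` and `c > -1`, and at infinity since `c < 0`.
  have key := integral_Ioi_mul_deriv_eq_deriv_mul hu hv hint hu'v hzero hinfty
  rw [key]
  have h4 : ∀ v : ℝ, -Real.exp (-v) * (v ^ c / c) = (-c⁻¹) * (Real.exp (-v) * v ^ (c + 1 - 1)) := by
    intro v
    rw [add_sub_cancel_right]
    ring
  simp_rw [h4]
  rw [integral_const_mul, ← Real.Gamma_eq_integral (by linarith), Real.Gamma_add_one hc0.ne]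
  field_simp
  simp

/-- Both `1` and `y` bound the left side, and `min 1 y ≤ 2y/(1+y)`; a power in `[0, 1]` only raises
a base below `1` and keeps a base above `1` above it. In this form the factor `y^{-a}` cancels the
singularity `y^a` in `macdonaldLaplace.abs_kernel_le`. -/
theorem one_sub_exp_neg_le {y a : ℝ} (hy : 0 < y) (ha1 : -1 ≤ a) (ha0 : a ≤ 0) :
    1 - Real.exp (-y) ≤ (2 * y / (1 + y)) ^ (-a) := by
  have hc : 0 < 2 * y / (1 + y) := by positivity
  have hy1 : 1 - Real.exp (-y) ≤ y := by linarith [Real.add_one_le_exp (-y)]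
  have hone : 1 - Real.exp (-y) ≤ 1 := by linarith [Real.exp_pos (-y)]
  rcases le_total (2 * y / (1 + y)) 1 with h | h
  · have h1 : y ≤ 2 * y / (1 + y) := by
      rw [div_le_one (by positivity)] at h
      rw [le_div_iff₀ (by positivity)]
      nlinarith
    calc 1 - Real.exp (-y) ≤ (2 * y / (1 + y)) ^ (1 : ℝ) := by rw [Real.rpow_one]; linarith
      _ ≤ _ := Real.rpow_le_rpow_of_exponent_ge hc h (by linarith)
  · exact hone.trans (Real.one_le_rpow h (by linarith))

/-! ### A Laplace integral solving the modified Bessel equation -/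

/-- The Laplace integral `∫₀^∞ e^{-x(1+u)} (u(u+2))^a du`, a multiple of
`x^{-a-1/2} K_{a+1/2}(x)`. -/
noncomputable def macdonaldLaplace (a x : ℝ) : ℝ :=
  ∫ u in Ioi (0 : ℝ), Real.exp (x * (-(1 + u))) * (u * (u + 2)) ^ a

namespace macdonaldLaplace

variable {a : ℝ}

theorem weight_le (ha0 : a ≤ 0) {u : ℝ} (hu : 0 < u) : (u * (u + 2)) ^ a ≤ u ^ a * (1 + u) ^ a := by
  rw [Real.mul_rpow hu.le (by linarith)]
  gcongr ?_ * ?_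
  exact Real.rpow_le_rpow_of_nonpos (by linarith) (by linarith) ha0

theorem integrableOn_weight (ha1 : -1 < a) (ha2 : a < -(1 / 2)) :
    IntegrableOn (fun u : ℝ => (u * (u + 2)) ^ a) (Ioi 0) := by
  refine Integrable.mono' (integrableOn_rpow_mul_one_add_rpow ha1 (b := a) (by linarith)
    (by linarith)) (by fun_prop : Measurable fun u : ℝ => (u * (u + 2)) ^ a).aestronglyMeasurable ?_
  filter_upwards [self_mem_ae_restrict measurableSet_Ioi] with u hu
  have hu0 : 0 < u := hu
  rw [Real.norm_of_nonneg (by positivity)]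
  exact weight_le (by linarith) hu0

theorem integrableOn (ha1 : -1 < a) (ha2 : a < -(1 / 2)) {x : ℝ} (hx : 0 < x) :
    IntegrableOn (fun u : ℝ => Real.exp (x * (-(1 + u))) * (u * (u + 2)) ^ a) (Ioi 0) := by
  refine Integrable.mono' (integrableOn_weight ha1 ha2) (by fun_prop : Measurable fun u : ℝ =>
    Real.exp (x * (-(1 + u))) * (u * (u + 2)) ^ a).aestronglyMeasurable ?_
  filter_upwards [self_mem_ae_restrict measurableSet_Ioi] with u hu
  have hu0 : 0 < u := hu
  rw [Real.norm_of_nonneg (by positivity)]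
  refine mul_le_of_le_one_left (by positivity) (Real.exp_le_one_iff.2 ?_)
  nlinarith

/-- The moments of the Laplace density. -/
noncomputable def moment (a : ℝ) (n : ℕ) (x : ℝ) : ℝ :=
  ∫ u in Ioi (0 : ℝ), (-(1 + u)) ^ n * Real.exp (x * (-(1 + u))) * (u * (u + 2)) ^ a

theorem aemeasurable_weight :
    AEMeasurable (fun u : ℝ => (u * (u + 2)) ^ a) (volume.restrict (Ioi 0)) :=
  (by fun_prop : Measurable fun u : ℝ => (u * (u + 2)) ^ a).aemeasurable

theorem weight_nonneg : ∀ᵐ u ∂volume.restrict (Ioi (0 : ℝ)), 0 ≤ (u * (u + 2)) ^ a := by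
  filter_upwards [self_mem_ae_restrict (measurableSet_Ioi (a := (0 : ℝ)))] with u hu
  have hu0 : 0 < u := hu
  positivity

theorem integrableOn_moment (ha1 : -1 < a) (ha2 : a < -(1 / 2)) (n : ℕ) {x : ℝ} (hx : 0 < x) :
    IntegrableOn (fun u : ℝ => (-(1 + u)) ^ n * Real.exp (x * (-(1 + u))) * (u * (u + 2)) ^ a)
      (Ioi 0) :=
  integrable_pow_mul_exp_mul aemeasurable_weight weight_nonneg
    (fun _ ht => integrableOn ha1 ha2 ht) n hx

theorem hasDerivAt_moment (ha1 : -1 < a) (ha2 : a < -(1 / 2)) (n : ℕ) {x : ℝ} (hx : 0 < x) :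
    HasDerivAt (moment a n) (moment a (n + 1) x) x :=
  hasDerivAt_integral_pow_mul_exp_mul aemeasurable_weight weight_nonneg
    (fun _ ht => integrableOn ha1 ha2 ht) n hx

theorem moment_zero : moment a 0 = macdonaldLaplace a := by
  ext x
  simp [moment, macdonaldLaplace]

/-- The total derivative of `(u(u+2))^{a+1} e^{-x(1+u)}` integrates to zero, its boundary value at
`u = 0` vanishing because `a > -1`; then use `u(u+2) = (1+u)² - 1`. As the moments are successive
derivatives, this is a differential equation for `macdonaldLaplace a`. -/
theorem moment_ode (ha1 : -1 < a) (ha2 : a < -(1 / 2)) {x : ℝ} (hx : 0 < x) :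
    x * moment a 2 x + (2 * a + 2) * moment a 1 x = x * moment a 0 x := by
  have i0 := integrableOn_moment ha1 ha2 0 hx
  have i1 := integrableOn_moment ha1 ha2 1 hx
  have i2 := integrableOn_moment ha1 ha2 2 hx
  set f : ℝ → ℝ := fun u => (u * (u + 2)) ^ (a + 1) * Real.exp (x * (-(1 + u))) with hf
  set f' : ℝ → ℝ := fun u =>
    x * ((-(1 + u)) ^ 0 * Real.exp (x * (-(1 + u))) * (u * (u + 2)) ^ a) -
    (x * ((-(1 + u)) ^ 2 * Real.exp (x * (-(1 + u))) * (u * (u + 2)) ^ a) +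
    (2 * a + 2) * ((-(1 + u)) ^ 1 * Real.exp (x * (-(1 + u))) * (u * (u + 2)) ^ a)) with hf'
  have hfi' : IntegrableOn f' (Ioi 0) :=
    (i0.const_mul x).sub ((i2.const_mul x).add (i1.const_mul (2 * a + 2)))
  have hpow : ∀ u : ℝ, 0 < u → (u * (u + 2)) ^ (a + 1) = (u * (u + 2)) ^ a * (u * (u + 2)) := by
    intro u hu
    rw [Real.rpow_add_one (by positivity)]
  have hfi : IntegrableOn f (Ioi 0) := by
    refine (i2.sub i0).congr_fun (fun u hu => ?_) measurableSet_Ioi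
    have hu0 : 0 < u := hu
    simp only [hf, Pi.sub_apply]
    rw [hpow u hu0]
    ring
  have hd : ∀ u ∈ Ioi (0 : ℝ), HasDerivAt f (f' u) u := by
    intro u hu
    have hu0 : 0 < u := hu
    have hb : HasDerivAt (fun u : ℝ => u * (u + 2)) (1 * (u + 2) + u * 1) u :=
      (hasDerivAt_id u).mul ((hasDerivAt_id u).add_const 2)
    have h1 := hb.rpow_const (p := a + 1) (Or.inl (by positivity))
    have h2 : HasDerivAt (fun u : ℝ => Real.exp (x * (-(1 + u))))
        (Real.exp (x * (-(1 + u))) * (x * (-1))) u :=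
      ((((hasDerivAt_id u).const_add 1).neg).const_mul x).exp
    convert! h1.mul h2 using 1
    simp only [hf']
    rw [hpow u hu0, add_sub_cancel_right]
    ring
  have hcont : ContinuousWithinAt f (Ici 0) 0 := by
    refine Continuous.continuousWithinAt ?_
    refine Continuous.mul ?_ (by fun_prop)
    exact (Real.continuous_rpow_const (by linarith)).comp (by fun_prop)
  have h := integral_Ioi_of_hasDerivAt_of_tendsto hcont hd hfi'
    (tendsto_zero_of_hasDerivAt_of_integrableOn_Ioi hd hfi' hfi)
  have hf0 : f 0 = 0 := by
    simp only [hf, zero_mul]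
    rw [Real.zero_rpow (by linarith), zero_mul]
  rw [hf0, sub_zero] at h
  simp only [hf'] at h
  have hsum := integral_add (i2.const_mul x) (i1.const_mul (2 * a + 2))
  have hdiff := integral_sub (i0.const_mul x) ((i2.const_mul x).add (i1.const_mul (2 * a + 2)))
  simp only [Pi.add_apply] at hdiff
  rw [hdiff, hsum, integral_const_mul, integral_const_mul, integral_const_mul] at h
  unfold moment
  linarith

theorem abs_kernel_le (ha1 : -1 < a) (ha2 : a < -(1 / 2)) {x v : ℝ} (hx : 0 ≤ x) (hv : 0 < v) :
    ‖(Real.exp (-(x + v)) - 1) * (v * (v + 2 * x)) ^ a‖ ≤ 2 ^ (-a) * (v ^ a * (1 + v) ^ a) := by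
  have hy : 0 < x + v := by linarith
  have h1 := one_sub_exp_neg_le hy ha1.le (by linarith : a ≤ 0)
  have h0 : 0 ≤ 1 - Real.exp (-(x + v)) := by
    have := Real.exp_le_one_iff.2 (by linarith : -(x + v) ≤ 0)
    linarith
  rw [norm_mul, norm_sub_rev, Real.norm_of_nonneg h0, Real.norm_of_nonneg (by positivity),
    Real.mul_rpow hv.le (by positivity)]
  calc (1 - Real.exp (-(x + v))) * (v ^ a * (v + 2 * x) ^ a)
      ≤ (2 * (x + v) / (1 + (x + v))) ^ (-a) * (v ^ a * (x + v) ^ a) := by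
        gcongr ?_ * (_ * ?_)
        exact Real.rpow_le_rpow_of_nonpos hy (by linarith) (by linarith)
    _ = 2 ^ (-a) * (v ^ a * (1 + (x + v)) ^ a) := by
        have h3 := (Real.rpow_pos_of_pos hy a).ne'
        rw [Real.div_rpow (by positivity) (by positivity), Real.mul_rpow two_pos.le hy.le,
          Real.rpow_neg hy.le, Real.rpow_neg (by positivity : 0 ≤ 1 + (x + v))]
        field_simp
    _ ≤ _ := by
        gcongr 2 ^ (-a) * (_ * ?_)
        exact Real.rpow_le_rpow_of_nonpos (by linarith) (by linarith) (by linarith)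

/-- The substitution `v = xu` extracts the power `x^{-2a-1}`. What remains tends, as `x → 0`, to the
integral of `(e^{-v} - 1) v^{2a}`, whose value is `Γ(2a+1)`; `abs_kernel_le` justifies the limit. -/
theorem sub_eq (ha1 : -1 < a) (ha2 : a < -(1 / 2)) {x : ℝ} (hx : 0 < x) :
    (macdonaldLaplace a x - ∫ u in Ioi (0 : ℝ), (u * (u + 2)) ^ a) / x ^ (-2 * a - 1) =
      ∫ v in Ioi (0 : ℝ), (Real.exp (-(x + v)) - 1) * (v * (v + 2 * x)) ^ a := by
  have h := integral_comp_mul_left_Ioi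
    (fun v : ℝ => (Real.exp (-(x + v)) - 1) * (v * (v + 2 * x)) ^ a) 0 hx
  rw [mul_zero] at h
  have h1 : ∀ u ∈ Ioi (0 : ℝ),
      (Real.exp (-(x + x * u)) - 1) * (x * u * (x * u + 2 * x)) ^ a =
      x ^ (2 * a) * (Real.exp (x * (-(1 + u))) * (u * (u + 2)) ^ a - (u * (u + 2)) ^ a) := by
    intro u hu
    have hu0 : 0 < u := hu
    rw [show x * u * (x * u + 2 * x) = x ^ 2 * (u * (u + 2)) by ring,
      Real.mul_rpow (by positivity) (by positivity), ← Real.rpow_natCast, ← Real.rpow_mul hx.le,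
      show -(x + x * u) = x * (-(1 + u)) by ring]
    push_cast
    ring
  rw [setIntegral_congr_fun measurableSet_Ioi h1, integral_const_mul,
    integral_sub (integrableOn ha1 ha2 hx) (integrableOn_weight ha1 ha2), smul_eq_mul] at h
  have h2 : x ^ (-2 * a - 1) = (x ^ (2 * a))⁻¹ * x⁻¹ := by
    rw [Real.rpow_sub_one hx.ne', neg_mul, Real.rpow_neg hx.le, div_eq_mul_inv]
  rw [h2]
  change x ^ (2 * a) * (macdonaldLaplace a x - _) = _ at h
  have h3 := (Real.rpow_pos_of_pos hx (2 * a)).ne'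
  rw [div_eq_iff (by positivity)]
  field_simp
  field_simp at h
  linarith

theorem tendsto (ha1 : -1 < a) (ha2 : a < -(1 / 2)) :
    Tendsto (fun x => (macdonaldLaplace a x - ∫ u in Ioi (0 : ℝ), (u * (u + 2)) ^ a) /
      x ^ (-2 * a - 1)) (𝓝[>] 0) (𝓝 (Real.Gamma (2 * a + 1))) := by
  have hbound : IntegrableOn (fun v : ℝ => 2 ^ (-a) * (v ^ a * (1 + v) ^ a)) (Ioi 0) :=
    (integrableOn_rpow_mul_one_add_rpow ha1 (by linarith) (by linarith)).const_mul _
  have hpow : ∀ v ∈ Ioi (0 : ℝ), (Real.exp (-v) - 1) * v ^ (2 * a + 1 - 1) =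
      (Real.exp (-(0 + v)) - 1) * (v * (v + 2 * 0)) ^ a := by
    intro v hv
    have hv0 : 0 < v := hv
    rw [zero_add, mul_zero, add_zero, Real.mul_rpow hv0.le hv0.le, ← Real.rpow_add hv0]
    ring_nf
  have hmeas : ∀ x : ℝ, Measurable fun v : ℝ =>
      (Real.exp (-(x + v)) - 1) * (v * (v + 2 * x)) ^ a := fun x => by fun_prop
  have hint : IntegrableOn (fun v : ℝ => (Real.exp (-v) - 1) * v ^ (2 * a + 1 - 1)) (Ioi 0) := by
    refine IntegrableOn.congr_fun ?_ (fun v hv => (hpow v hv).symm) measurableSet_Ioi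
    refine Integrable.mono' hbound (hmeas 0).aestronglyMeasurable ?_
    filter_upwards [self_mem_ae_restrict measurableSet_Ioi] with v hv
    exact abs_kernel_le ha1 ha2 le_rfl hv
  rw [← integral_exp_neg_sub_one_mul_rpow (c := 2 * a + 1) (by linarith) (by linarith) hint,
    setIntegral_congr_fun measurableSet_Ioi hpow]
  refine Tendsto.congr' (f₁ := fun x => ∫ v in Ioi (0 : ℝ),
    (Real.exp (-(x + v)) - 1) * (v * (v + 2 * x)) ^ a) ?_ ?_
  · filter_upwards [self_mem_nhdsWithin] with x hx using (sub_eq ha1 ha2 hx).symm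
  · refine tendsto_integral_filter_of_dominated_convergence _
      (Eventually.of_forall fun x => (hmeas x).aestronglyMeasurable) ?_ hbound ?_
    · filter_upwards [self_mem_nhdsWithin] with x hx
      filter_upwards [self_mem_ae_restrict measurableSet_Ioi] with v hv
      exact abs_kernel_le ha1 ha2 (le_of_lt hx) hv
    · filter_upwards [self_mem_ae_restrict measurableSet_Ioi] with v hv
      have hv0 : 0 < v := hv
      refine Tendsto.mono_left (ContinuousAt.tendsto (x := (0 : ℝ)) (f := fun x =>
        (Real.exp (-(x + v)) - 1) * (v * (v + 2 * x)) ^ a) ?_) nhdsWithin_le_nhds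
      refine ContinuousAt.mul (by fun_prop) ?_
      refine ContinuousAt.rpow_const (by fun_prop) (Or.inl ?_)
      simp only [mul_zero, add_zero]
      positivity

/-- The Laplace integral in terms of the two power series solutions. -/
theorem eq_besselEntire {μ : ℝ} (hμ0 : 0 < μ) (hμ1 : μ < 1 / 2) {x : ℝ} (hx : 0 < x) :
    macdonaldLaplace (-μ - 1 / 2) x =
      (∫ u in Ioi (0 : ℝ), (u * (u + 2)) ^ (-μ - 1 / 2)) * Real.Gamma (1 - μ) *
          besselEntire.real (1 - μ) (x ^ 2 / 4) +
        Real.Gamma (-2 * μ) * Real.Gamma (1 + μ) *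
          (x ^ (2 * μ) * besselEntire.real (1 + μ) (x ^ 2 / 4)) := by
  have ha1 : -1 < -μ - 1 / 2 := by linarith
  have ha2 : -μ - 1 / 2 < -(1 / 2) := by linarith
  -- With `a = -μ - 1/2` one has `2a + 2 = 1 - 2μ`, so `moment_ode` is the second equation of the
  -- system for `p = x^{1-2μ} y'`.
  refine besselEntire.eq_of_system hμ0 (by linarith)
    (p := fun x => x ^ (1 - 2 * μ) * moment (-μ - 1 / 2) 1 x) ?_ ?_ ?_ hx
  · intro x hx
    rw [← moment_zero]
    convert hasDerivAt_moment ha1 ha2 0 hx using 1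
    rw [← mul_assoc, ← Real.rpow_add hx]
    simp
  · intro x hx
    convert! (Real.hasDerivAt_rpow_const (x := x) (p := 1 - 2 * μ) (Or.inl hx.ne')).mul
      (hasDerivAt_moment ha1 ha2 1 hx) using 1
    have h := moment_ode ha1 ha2 hx
    have h2 : x ^ (1 - 2 * μ) = x ^ (1 - 2 * μ - 1) * x := by
      rw [← Real.rpow_add_one hx.ne', sub_add_cancel]
    rw [← moment_zero, h2]
    linear_combination (-x ^ (1 - 2 * μ - 1)) * h
  · have h := tendsto ha1 ha2
    rw [show 2 * (-μ - 1 / 2) + 1 = -2 * μ by ring,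
      show -2 * (-μ - 1 / 2) - 1 = 2 * μ by ring] at h
    exact h

end macdonaldLaplace

/-! ### The integral representing `K_ν` -/

/-- The integral `∫₀^∞ e^{-s} s^{ν-1/2} (1 + sζ)^{ν-1/2} ds`. -/
noncomputable def macdonaldCore (ν : ℝ) (ζ : ℂ) : ℂ :=
  ∫ s in Ioi (0 : ℝ), ((Real.exp (-s) * s ^ (ν - 1 / 2) : ℝ) : ℂ) *
    (1 + s * ζ) ^ ((ν - 1 / 2 : ℝ) : ℂ)

/-- The integral `∫₀^∞ e^{-s} s^{ν-1/2} (1 + sζ)^{ν-1/2} ds` for real `ζ`. -/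
noncomputable def macdonaldCoreReal (ν ζ : ℝ) : ℝ :=
  ∫ s in Ioi (0 : ℝ), Real.exp (-s) * s ^ (ν - 1 / 2) * (1 + s * ζ) ^ (ν - 1 / 2)

/-- The function `(π/(2z))^{1/2} e^{-z} / Γ(ν+1/2) ∫₀^∞ e^{-s} s^{ν-1/2} (1 + s/(2z))^{ν-1/2} ds`,
which represents `K_ν(z)` on the whole slit plane. -/
noncomputable def macdonald (ν : ℝ) (z : ℂ) : ℂ :=
  (Real.pi / (2 * z)) ^ ((1 / 2 : ℝ) : ℂ) * Complex.exp (-z) / (Real.Gamma (ν + 1 / 2) : ℂ) *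
    macdonaldCore ν (2 * z)⁻¹

theorem macdonaldCore_ofReal (ν : ℝ) {ζ : ℝ} (hζ : 0 ≤ ζ) :
    macdonaldCore ν ζ = (macdonaldCoreReal ν ζ : ℂ) := by
  unfold macdonaldCore macdonaldCoreReal
  rw [← integral_complex_ofReal]
  refine setIntegral_congr_fun measurableSet_Ioi fun s hs => ?_
  have hs0 : 0 < s := hs
  have h : (0 : ℝ) ≤ 1 + s * ζ := by positivity
  rw [Complex.ofReal_mul _ ((1 + s * ζ) ^ (ν - 1 / 2)), Complex.ofReal_cpow h]
  push_cast
  rfl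

/-- Expanding `(1 + sζ)^{ν-1/2}` as a Gamma integral in `r` gives a double integral that is
invariant under exchanging `s` with `r` and `ν` with `-ν`. -/
theorem macdonaldCoreReal_neg {ν ζ : ℝ} (hν1 : -(1 / 2) < ν) (hν2 : ν < 1 / 2) (hζ : 0 ≤ ζ) :
    macdonaldCoreReal (-ν) ζ / Real.Gamma (-ν + 1 / 2) =
      macdonaldCoreReal ν ζ / Real.Gamma (ν + 1 / 2) := by
  have hG1 : 0 < Real.Gamma (-ν + 1 / 2) := Real.Gamma_pos_of_pos (by linarith)
  have hG2 : 0 < Real.Gamma (ν + 1 / 2) := Real.Gamma_pos_of_pos (by linarith)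
  set f : ℝ → ℝ → ℝ → ℝ := fun ν s r =>
    Real.exp (-s) * s ^ (ν - 1 / 2) * (r ^ (-ν + 1 / 2 - 1) * Real.exp (-((1 + s * ζ) * r))) with hf
  have hin : ∀ ν s : ℝ, ν < 1 / 2 → 0 < s → ∫ r in Ioi (0 : ℝ), f ν s r =
      Real.exp (-s) * s ^ (ν - 1 / 2) * (1 + s * ζ) ^ (ν - 1 / 2) * Real.Gamma (-ν + 1 / 2) := by
    intro ν s hν hs
    have h : 0 < 1 + s * ζ := by positivity
    simp only [hf]
    rw [integral_const_mul, Real.integral_rpow_mul_exp_neg_mul_Ioi (by linarith) h,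
      one_div (1 + s * ζ), Real.inv_rpow h.le, ← Real.rpow_neg h.le,
      show -(-ν + 1 / 2) = ν - 1 / 2 by ring]
    ring
  have hsymm : ∀ s r : ℝ, f ν s r = f (-ν) r s := by
    intro s r
    simp only [hf, neg_neg]
    have h1 : Real.exp (-((1 + s * ζ) * r)) = Real.exp (-r) * Real.exp (-(s * r * ζ)) := by
      rw [← Real.exp_add]; ring_nf
    have h2 : Real.exp (-((1 + r * ζ) * s)) = Real.exp (-s) * Real.exp (-(s * r * ζ)) := by
      rw [← Real.exp_add]; ring_nf
    rw [h1, h2, show -ν + 1 / 2 - 1 = -ν - 1 / 2 by ring, show ν + 1 / 2 - 1 = ν - 1 / 2 by ring]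
    ring
  have hswap := integral_Ioi_swap_of_nonneg (f := f ν) ?_ ?_ ?_ ?_
  · rw [setIntegral_congr_fun measurableSet_Ioi (fun s hs => hin ν s hν2 hs)] at hswap
    simp_rw [hsymm] at hswap
    rw [setIntegral_congr_fun measurableSet_Ioi (fun r hr => hin (-ν) r (by linarith) hr),
      integral_mul_const, integral_mul_const, neg_neg] at hswap
    rw [div_eq_div_iff hG1.ne' hG2.ne']
    exact hswap.symm
  · simp only [hf, Function.uncurry_def]
    fun_prop
  · intro s hs r hr
    simp only [hf]
    have h : 0 < 1 + s * ζ := by positivity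
    positivity
  · intro s hs
    have h : 0 < 1 + s * ζ := by positivity
    exact (integrableOn_rpow_mul_exp_neg (s := -ν + 1 / 2 - 1) (by linarith) h).const_mul _
  · refine IntegrableOn.congr_fun ?_ (fun s hs => (hin ν s hν2 hs).symm) measurableSet_Ioi
    refine Integrable.mul_const ?_ _
    refine Integrable.mono' (integrableOn_rpow_mul_exp_neg (s := ν - 1 / 2) (by linarith) one_pos)
      (by fun_prop : Measurable fun s : ℝ =>
        Real.exp (-s) * s ^ (ν - 1 / 2) * (1 + s * ζ) ^ (ν - 1 / 2)).aestronglyMeasurable ?_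
    filter_upwards [self_mem_ae_restrict measurableSet_Ioi] with s hs
    have hs0 : 0 < s := hs
    have h : 1 ≤ 1 + s * ζ := by nlinarith
    rw [Real.norm_of_nonneg (by positivity), one_mul, mul_comm (Real.exp (-s))]
    exact mul_le_of_le_one_right (by positivity)
      (Real.rpow_le_one_of_one_le_of_nonpos h (by linarith))

theorem macdonaldLaplace_eq_core {a x : ℝ} (hx : 0 < x) :
    macdonaldLaplace a x =
      Real.exp (-x) * x ^ (-a - 1) * 2 ^ a * macdonaldCoreReal (a + 1 / 2) (2 * x)⁻¹ := by
  have h := integral_comp_mul_left_Ioi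
    (fun s : ℝ => Real.exp (-s) * s ^ a * (1 + s * (2 * x)⁻¹) ^ a) 0 hx
  rw [mul_zero] at h
  have h1 : ∀ u ∈ Ioi (0 : ℝ),
      Real.exp (-(x * u)) * (x * u) ^ a * (1 + x * u * (2 * x)⁻¹) ^ a =
      x ^ a * 2 ^ (-a) * Real.exp x * (Real.exp (x * (-(1 + u))) * (u * (u + 2)) ^ a) := by
    intro u hu
    have hu0 : 0 < u := hu
    have e1 : Real.exp (-(x * u)) = Real.exp x * Real.exp (x * (-(1 + u))) := by
      rw [← Real.exp_add]; ring_nf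
    have e2 : 1 + x * u * (2 * x)⁻¹ = 2⁻¹ * (u + 2) := by field_simp; ring
    rw [e1, e2, Real.mul_rpow hx.le hu0.le, Real.mul_rpow (by norm_num) (by linarith),
      Real.mul_rpow hu0.le (by linarith), Real.inv_rpow two_pos.le, Real.rpow_neg two_pos.le]
    ring
  rw [setIntegral_congr_fun measurableSet_Ioi h1, integral_const_mul, smul_eq_mul] at h
  unfold macdonaldLaplace macdonaldCoreReal
  simp only [add_sub_cancel_right]
  have e3 : x ^ (-a - 1) = (x ^ a)⁻¹ * x⁻¹ := by
    rw [Real.rpow_sub_one hx.ne', Real.rpow_neg hx.le, div_eq_mul_inv]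
  have e4 := (Real.rpow_pos_of_pos hx a).ne'
  have e5 := (Real.rpow_pos_of_pos two_pos a).ne'
  rw [mul_assoc (_ * _) _ (integral _ _), e3, Real.exp_neg]
  rw [Real.rpow_neg two_pos.le] at h
  have h' : ∫ s in Ioi (0 : ℝ), Real.exp (-s) * s ^ a * (1 + s * (2 * x)⁻¹) ^ a = x *
    (x ^ a * (2 ^ a)⁻¹ * Real.exp x *
      ∫ u in Ioi (0 : ℝ), Real.exp (x * (-(1 + u))) * (u * (u + 2)) ^ a) := by
    rw [h]; field_simp
  rw [h']
  field_simp

/-! ### Identification of `K_ν` on the positive axis -/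

theorem besselKQuotient_neg (ν : ℝ) (z : ℂ) : besselKQuotient (-ν) z = besselKQuotient ν z := by
  unfold besselKQuotient
  rw [neg_neg, neg_mul, Real.sin_neg, Complex.ofReal_neg, div_neg, ← neg_div]
  ring_nf

theorem besselI_ofReal (ν : ℝ) {x : ℝ} (hx : 0 < x) :
    besselI ν x = (((x / 2) ^ ν * besselEntire.real (ν + 1) (x ^ 2 / 4) : ℝ) : ℂ) := by
  have h : ((x : ℂ)) ^ 2 / 4 = ((x ^ 2 / 4 : ℝ) : ℂ) := by push_cast; rfl
  rw [besselI_eq_besselEntire, h, besselEntire.ofReal, Complex.ofReal_mul,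
    Complex.ofReal_cpow (by positivity)]
  push_cast
  rfl

theorem besselKQuotient_ofReal (ν : ℝ) {x : ℝ} (hx : 0 < x) :
    besselKQuotient ν x = ((Real.pi / 2 * ((x / 2) ^ (-ν) * besselEntire.real (1 - ν) (x ^ 2 / 4) -
      (x / 2) ^ ν * besselEntire.real (1 + ν) (x ^ 2 / 4)) / Real.sin (ν * Real.pi) : ℝ) : ℂ) := by
  unfold besselKQuotient
  rw [besselI_ofReal _ hx, besselI_ofReal _ hx, show -ν + 1 = 1 - ν by ring, add_comm ν 1]
  push_cast
  rfl

theorem macdonald_ofReal (ν : ℝ) {x : ℝ} (hx : 0 < x) :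
    macdonald ν x = ((Real.sqrt (Real.pi / (2 * x)) * Real.exp (-x) / Real.Gamma (ν + 1 / 2) *
      macdonaldCoreReal ν (2 * x)⁻¹ : ℝ) : ℂ) := by
  unfold macdonald
  have h1 : (2 * (x : ℂ))⁻¹ = (((2 * x)⁻¹ : ℝ) : ℂ) := by push_cast; rfl
  have h2 : (Real.pi : ℂ) / (2 * (x : ℂ)) = ((Real.pi / (2 * x) : ℝ) : ℂ) := by push_cast; rfl
  have h3 : 0 ≤ Real.pi / (2 * x) := by positivity
  rw [h1, h2, macdonaldCore_ofReal _ (by positivity), ← Complex.ofReal_cpow h3,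
    ← Real.sqrt_eq_rpow]
  push_cast
  rfl

theorem macdonald_neg_ofReal {ν x : ℝ} (hν1 : -(1 / 2) < ν) (hν2 : ν < 1 / 2) (hx : 0 < x) :
    macdonald (-ν) x = macdonald ν x := by
  rw [macdonald_ofReal _ hx, macdonald_ofReal _ hx]
  have h := macdonaldCoreReal_neg hν1 hν2 (ζ := (2 * x)⁻¹) (by positivity)
  rw [div_mul_eq_mul_div, mul_div_assoc, h, ← mul_div_assoc, ← div_mul_eq_mul_div]

/-- The index is `-μ` because `a = -μ - 1/2 < -1/2` makes the Laplace integral finite at `x = 0`.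
The duplication formula at `±μ` reduces its two coefficients to multiples of `Γ(±μ)/2`, and the
reflection formula turns these into `±(π/2) / sin(μπ)`. -/
theorem besselKQuotient_eq_macdonald_neg_ofReal {μ x : ℝ} (hμ0 : 0 < μ) (hμ1 : μ < 1 / 2)
    (hx : 0 < x) : besselKQuotient μ x = macdonald (-μ) x := by
  rw [besselKQuotient_ofReal _ hx, macdonald_ofReal _ hx, Complex.ofReal_inj]
  have hL := macdonaldLaplace.eq_besselEntire hμ0 hμ1 hx
  rw [macdonaldLaplace_eq_core hx, integral_mul_add_two_rpow (by linarith) (by linarith),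
    show -μ - 1 / 2 + 1 = -μ + 1 / 2 by ring, show -2 * (-μ - 1 / 2) - 1 = 2 * μ by ring,
    show 2 * (-μ - 1 / 2) + 1 = -(2 * μ) by ring, show -(-μ - 1 / 2) = μ + 1 / 2 by ring,
    show -μ - 1 / 2 + 1 / 2 = -μ by ring, show μ + 1 / 2 - 1 = μ - 1 / 2 by ring] at hL
  have hd1 := Real.Gamma_mul_Gamma_add_half μ
  have hd2 := Real.Gamma_mul_Gamma_add_half (-μ)
  have hr1 := Real.Gamma_mul_Gamma_one_sub μ
  have hr2 := Real.Gamma_mul_Gamma_one_sub (-μ)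
  rw [sub_neg_eq_add, mul_neg, Real.sin_neg] at hr2
  rw [mul_neg, sub_neg_eq_add] at hd2
  have hG1 : 0 < Real.Gamma (-μ + 1 / 2) := Real.Gamma_pos_of_pos (by linarith)
  have hG2 : 0 < Real.Gamma (μ + 1 / 2) := Real.Gamma_pos_of_pos (by linarith)
  have hsin : 0 < Real.sin (μ * Real.pi) := by
    refine Real.sin_pos_of_pos_of_lt_pi (by positivity) ?_
    nlinarith [Real.pi_pos]
  rw [mul_comm Real.pi μ] at hr1 hr2
  set M := macdonaldCoreReal (-μ) (2 * x)⁻¹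
  set R₁ := besselEntire.real (1 - μ) (x ^ 2 / 4)
  set R₂ := besselEntire.real (1 + μ) (x ^ 2 / 4)
  set S := Real.sin (μ * Real.pi)
  rw [neg_mul] at hL
  have ht : 0 < (2 : ℝ) ^ μ := by positivity
  have hxm : 0 < x ^ μ := by positivity
  have e1 : (2 : ℝ) ^ (2 * μ) = 2 ^ μ * 2 ^ μ := by rw [two_mul, Real.rpow_add two_pos]
  have e2 : x ^ (2 * μ) = x ^ μ * x ^ μ := by rw [two_mul, Real.rpow_add hx]
  have e3 : (2 : ℝ) ^ (1 - 2 * μ) = 2 / (2 ^ μ * 2 ^ μ) := by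
    rw [Real.rpow_sub two_pos, Real.rpow_one, e1]
  have e4 : (2 : ℝ) ^ (1 + 2 * μ) = 2 * (2 ^ μ * 2 ^ μ) := by
    rw [Real.rpow_add two_pos, Real.rpow_one, e1]
  have e5 : (2 : ℝ) ^ (-(2 * μ)) = (2 ^ μ * 2 ^ μ)⁻¹ := by rw [Real.rpow_neg two_pos.le, e1]
  have e6 : (2 : ℝ) ^ (-μ - 1 / 2) = (2 ^ μ)⁻¹ * (Real.sqrt 2)⁻¹ := by
    rw [Real.rpow_sub two_pos, Real.rpow_neg two_pos.le, ← Real.sqrt_eq_rpow, div_eq_mul_inv]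
  have e7 : x ^ (μ - 1 / 2) = x ^ μ * (Real.sqrt x)⁻¹ := by
    rw [Real.rpow_sub hx, ← Real.sqrt_eq_rpow, div_eq_mul_inv]
  have e8 : (x / 2) ^ (-μ) = 2 ^ μ / x ^ μ := by
    rw [Real.rpow_neg (by positivity), Real.div_rpow hx.le two_pos.le, inv_div]
  have e9 : (x / 2) ^ μ = x ^ μ / 2 ^ μ := Real.div_rpow hx.le two_pos.le _
  have e10 : Real.sqrt (Real.pi / (2 * x)) = Real.sqrt Real.pi * (Real.sqrt 2)⁻¹ * (Real.sqrt x)⁻¹ := by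
    rw [Real.sqrt_div Real.pi_pos.le, Real.sqrt_mul two_pos.le]
    field_simp
  rw [e6, e7, e5, e2] at hL
  rw [e3] at hd1
  rw [e4] at hd2
  rw [e8, e9, e10]
  generalize Real.Gamma (-μ + 1 / 2) = g₁ at hL hd2 hG1 ⊢
  generalize Real.Gamma (μ + 1 / 2) = g₂ at hL hd1 hG2 ⊢
  have k1 : Real.Gamma (2 * μ) * Real.sqrt Real.pi / (2 ^ μ * 2 ^ μ) / g₂ =
      Real.Gamma μ / 2 := by
    field_simp at hd1 ⊢
    linarith
  have k2 : Real.Gamma (-(2 * μ)) * Real.sqrt Real.pi * (2 ^ μ * 2 ^ μ) / g₁ =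
      Real.Gamma (-μ) / 2 := by
    field_simp at hd2 ⊢
    linarith
  have hM : Real.sqrt Real.pi * (Real.sqrt 2)⁻¹ * (Real.sqrt x)⁻¹ * Real.exp (-x) /
      g₁ * M =
      Real.sqrt Real.pi * (2 ^ μ / x ^ μ) / g₁ *
      (Real.exp (-x) * (x ^ μ * (Real.sqrt x)⁻¹) * ((2 ^ μ)⁻¹ * (Real.sqrt 2)⁻¹) * M) := by
    field_simp
  rw [hM, hL]
  have hfin : Real.sqrt Real.pi * (2 ^ μ / x ^ μ) / g₁ *
      (g₁ * Real.Gamma (2 * μ) * (2 ^ μ * 2 ^ μ)⁻¹ / g₂ *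
        Real.Gamma (1 - μ) * R₁ +
        Real.Gamma (-(2 * μ)) * Real.Gamma (1 + μ) * (x ^ μ * x ^ μ * R₂)) =
      (2 ^ μ / x ^ μ) * (Real.Gamma (2 * μ) * Real.sqrt Real.pi / (2 ^ μ * 2 ^ μ) /
        g₂) * Real.Gamma (1 - μ) * R₁ +
      (x ^ μ / 2 ^ μ) * (Real.Gamma (-(2 * μ)) * Real.sqrt Real.pi * (2 ^ μ * 2 ^ μ) /
        g₁) * Real.Gamma (1 + μ) * R₂ := by
    field_simp
  rw [hfin, k1, k2]
  have hr1' : Real.Gamma μ / 2 * Real.Gamma (1 - μ) = Real.pi / 2 / S := by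
    rw [div_mul_eq_mul_div, hr1]; ring
  have hr2' : Real.Gamma (-μ) / 2 * Real.Gamma (1 + μ) = -(Real.pi / 2 / S) := by
    rw [div_mul_eq_mul_div, hr2, div_neg]; ring
  linear_combination (-(2 ^ μ / x ^ μ) * R₁) * hr1' - (x ^ μ / 2 ^ μ * R₂) * hr2'

theorem besselKQuotient_eq_macdonald_ofReal {ν x : ℝ} (hν1 : -(1 / 2) < ν) (hν2 : ν < 1 / 2)
    (hν0 : ν ≠ 0) (hx : 0 < x) : besselKQuotient ν x = macdonald ν x := by
  rcases hν0.lt_or_gt with h | h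
  · rw [← besselKQuotient_neg, besselKQuotient_eq_macdonald_neg_ofReal (by linarith)
      (by linarith) hx, neg_neg]
  · rw [besselKQuotient_eq_macdonald_neg_ofReal h hν2 hx, macdonald_neg_ofReal hν1 hν2 hx]

/-- For `μ = 1/2` the system is `y' = p`, `p' = y`, and `e^{-x} = 1 - x + o(x)` gives `A = 1`, `B =
-1`. The Laplace integral cannot be used: its exponent `-μ - 1/2` would be `-1`. -/
theorem besselKQuotient_half_ofReal {x : ℝ} (hx : 0 < x) :
    besselKQuotient (1 / 2) x = ((Real.sqrt (Real.pi / (2 * x)) * Real.exp (-x) : ℝ) : ℂ) := by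
  rw [besselKQuotient_ofReal _ hx, Complex.ofReal_inj]
  have h := besselEntire.eq_of_system (μ := 1 / 2) (by norm_num) (by norm_num)
    (y := fun x => Real.exp (-x)) (p := fun x => -Real.exp (-x)) (A := 1) (B := -1) ?_ ?_ ?_ hx
  · rw [show 2 * (1 / 2 : ℝ) = 1 by norm_num, Real.rpow_one,
      show (1 : ℝ) - 1 / 2 = 1 / 2 by norm_num, add_comm (1 : ℝ) (1 / 2),
      Real.Gamma_add_one (by norm_num), Real.Gamma_one_half_eq] at h
    rw [show 1 / 2 * Real.pi = Real.pi / 2 by ring, Real.sin_pi_div_two, h,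
      show (1 : ℝ) - 1 / 2 = 1 / 2 by norm_num, add_comm (1 : ℝ) (1 / 2),
      Real.rpow_neg (by positivity), ← Real.sqrt_eq_rpow]
    have e1 : Real.sqrt (x / 2) * Real.sqrt (x / 2) = x / 2 := Real.mul_self_sqrt (by positivity)
    have e2 : Real.sqrt Real.pi * Real.sqrt Real.pi = Real.pi := Real.mul_self_sqrt Real.pi_pos.le
    have e3 : Real.sqrt (Real.pi / (2 * x)) = Real.sqrt Real.pi / (2 * Real.sqrt (x / 2)) := by
      rw [show Real.pi / (2 * x) = Real.pi / (2 ^ 2 * (x / 2)) by field_simp,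
        Real.sqrt_div Real.pi_pos.le, Real.sqrt_mul (by positivity), Real.sqrt_sq two_pos.le]
    have e4 : 0 < Real.sqrt (x / 2) := Real.sqrt_pos.2 (by positivity)
    rw [e3]
    field_simp
    rw [show Real.sqrt (x / 2) ^ 2 = x / 2 by rw [sq, e1], show Real.sqrt Real.pi ^ 2 = Real.pi by
      rw [sq, e2]]
    ring
  · intro x hx
    have := (hasDerivAt_id x).neg.exp
    convert! this using 1
    norm_num
  · intro x hx
    have := ((hasDerivAt_id x).neg.exp).neg
    convert! this using 1
    norm_num
  · have h1 : HasDerivAt (fun v : ℝ => Real.exp (-v)) (-1) 0 := by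
      simpa using! (hasDerivAt_id (0 : ℝ)).neg.exp
    have h2 := (h1.tendsto_slope_zero).mono_left
      (nhdsWithin_mono (0 : ℝ) (fun x (hx : 0 < x) => ne_of_gt hx) : 𝓝[>] (0 : ℝ) ≤ 𝓝[≠] 0)
    refine h2.congr fun x => ?_
    simp [div_eq_inv_mul]

/-! ### Analytic continuation to the slit plane -/

theorem ofReal_cpow_measurable (ζ c : ℂ) : Measurable fun s : ℝ => (1 + (s : ℂ) * ζ) ^ c := by
  have h : Measurable fun s : ℝ => 1 + (s : ℂ) * ζ := by fun_prop
  exact h.pow_const c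

theorem macdonaldCore_integrand_measurable (ν : ℝ) (ζ : ℂ) :
    Measurable fun s : ℝ => ((Real.exp (-s) * s ^ (ν - 1 / 2) : ℝ) : ℂ) *
      (1 + s * ζ) ^ ((ν - 1 / 2 : ℝ) : ℂ) := by
  have h : Measurable fun s : ℝ => Real.exp (-s) * s ^ (ν - 1 / 2) := by fun_prop
  exact (Complex.measurable_ofReal.comp h).mul (ofReal_cpow_measurable _ _)

theorem norm_one_add_mul_cpow_le {ζ : ℂ} {m s a : ℝ} (hm : 0 < m) (hs : 0 ≤ s) (ha : a ≤ 0)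
    (h : m * (1 + s) ≤ ‖1 + s * ζ‖) : ‖(1 + s * ζ) ^ (a : ℂ)‖ ≤ m ^ a :=
  Complex.norm_cpow_ofReal_le ha hm (le_trans (by nlinarith) h)

theorem macdonaldCore_differentiableOn {ν : ℝ} (hν1 : -(1 / 2) < ν) (hν2 : ν ≤ 1 / 2) :
    DifferentiableOn ℂ (macdonaldCore ν) Complex.slitPlane := by
  refine differentiableOn_integral_of_dominated
    (fun ζ _ => (macdonaldCore_integrand_measurable ν ζ).aestronglyMeasurable) ?_ ?_
  · filter_upwards [self_mem_ae_restrict measurableSet_Ioi] with s hs ζ hζ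
    have hs0 : 0 < s := hs
    refine DifferentiableAt.differentiableWithinAt ?_
    refine (DifferentiableAt.cpow (by fun_prop) (by fun_prop) ?_).const_mul _
    exact Complex.one_add_ofReal_mul_mem_slitPlane hζ hs0.le
  · intro ζ₀ hζ₀
    obtain ⟨r, hr, m, hm, hm1, hb⟩ := Complex.exists_ball_le_norm_one_add_mul hζ₀
    refine ⟨r, hr, fun s => s ^ (ν - 1 / 2) * Real.exp (-(1 * s)) * m ^ (ν - 1 / 2),
      Integrable.mul_const (integrableOn_rpow_mul_exp_neg (by linarith) one_pos) _,
      fun z hz => (hb z hz).1, ?_⟩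
    filter_upwards [self_mem_ae_restrict measurableSet_Ioi] with s hs ζ hζ
    have hs0 : 0 < s := hs
    rw [norm_mul, Complex.norm_real, Real.norm_of_nonneg (by positivity), one_mul,
      mul_comm (Real.exp _)]
    gcongr
    exact norm_one_add_mul_cpow_le hm hs0.le (by linarith) ((hb ζ hζ).2 s hs0.le)

theorem two_mul_mem_slitPlane {z : ℂ} (hz : z ∈ Complex.slitPlane) : 2 * z ∈ Complex.slitPlane := by
  rcases hz with h | h
  · left; simpa using h
  · right; simpa using h

theorem ofReal_mul_mem_slitPlane {r : ℝ} (hr : 0 < r) {z : ℂ} (hz : z ∈ Complex.slitPlane) :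
    r * z ∈ Complex.slitPlane := by
  rcases hz with h | h
  · left; rw [Complex.re_ofReal_mul]; positivity
  · right; rw [Complex.im_ofReal_mul]; exact mul_ne_zero hr.ne' h

theorem pi_div_two_mul_mem_slitPlane {z : ℂ} (hz : z ∈ Complex.slitPlane) :
    (Real.pi : ℂ) / (2 * z) ∈ Complex.slitPlane := by
  rw [div_eq_mul_inv]
  exact ofReal_mul_mem_slitPlane Real.pi_pos
    (Complex.inv_mem_slitPlane_of_mem (two_mul_mem_slitPlane hz))

theorem macdonald_prefactor_differentiableOn (c : ℂ) :
    DifferentiableOn ℂ (fun z => ((Real.pi : ℂ) / (2 * z)) ^ c * Complex.exp (-z))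
      Complex.slitPlane := by
  intro z hz
  have h0 : 2 * z ≠ 0 := Complex.slitPlane_ne_zero (two_mul_mem_slitPlane hz)
  refine DifferentiableAt.differentiableWithinAt (DifferentiableAt.mul ?_ (by fun_prop))
  exact DifferentiableAt.cpow (DifferentiableAt.div (by fun_prop) (by fun_prop) h0) (by fun_prop)
    (pi_div_two_mul_mem_slitPlane hz)

theorem macdonald_differentiableOn {ν : ℝ} (hν1 : -(1 / 2) < ν) (hν2 : ν ≤ 1 / 2) :
    DifferentiableOn ℂ (macdonald ν) Complex.slitPlane := by
  refine ((macdonald_prefactor_differentiableOn _).div_const _).mul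
    ((macdonaldCore_differentiableOn hν1 hν2).comp ?_ ?_)
  · intro z hz
    have h0 : 2 * z ≠ 0 := Complex.slitPlane_ne_zero (two_mul_mem_slitPlane hz)
    exact (DifferentiableAt.inv (by fun_prop) h0).differentiableWithinAt
  · intro z hz
    exact Complex.inv_mem_slitPlane_of_mem (two_mul_mem_slitPlane hz)

theorem half_mem_slitPlane {z : ℂ} (hz : z ∈ Complex.slitPlane) : z / 2 ∈ Complex.slitPlane := by
  have := ofReal_mul_mem_slitPlane (r := 1 / 2) (by norm_num) hz
  convert this using 1
  push_cast
  ring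

theorem besselI_differentiableOn {ν : ℝ} (hν : -1 < ν) :
    DifferentiableOn ℂ (besselI ν) Complex.slitPlane := by
  have h : besselI ν = fun z => (z / 2) ^ (ν : ℂ) * besselEntire (ν + 1) (z ^ 2 / 4) :=
    funext (besselI_eq_besselEntire ν)
  rw [h]
  intro z hz
  refine DifferentiableAt.differentiableWithinAt (DifferentiableAt.mul ?_ ?_)
  · exact DifferentiableAt.cpow (by fun_prop) (by fun_prop) (half_mem_slitPlane hz)
  · exact ((besselEntire.differentiable (by linarith)) _).comp z (by fun_prop)

theorem besselKQuotient_differentiableOn {ν : ℝ} (hν1 : -1 < ν) (hν2 : ν < 1) :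
    DifferentiableOn ℂ (besselKQuotient ν) Complex.slitPlane :=
  (((besselI_differentiableOn (by linarith)).sub
    (besselI_differentiableOn hν1)).const_mul _).div_const _

theorem besselKQuotient_eq_macdonald {ν : ℝ} (hν1 : -(1 / 2) < ν) (hν2 : ν < 1 / 2)
    (hν0 : ν ≠ 0) {z : ℂ} (hz : z ∈ Complex.slitPlane) : besselKQuotient ν z = macdonald ν z :=
  eqOn_slitPlane_of_eqOn_pos (besselKQuotient_differentiableOn (by linarith) (by linarith))
    (macdonald_differentiableOn hν1 hν2.le)
    (fun _ hx => besselKQuotient_eq_macdonald_ofReal hν1 hν2 hν0 hx) hz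

theorem macdonald_neg {ν : ℝ} (hν1 : -(1 / 2) < ν) (hν2 : ν < 1 / 2) {z : ℂ}
    (hz : z ∈ Complex.slitPlane) : macdonald (-ν) z = macdonald ν z :=
  eqOn_slitPlane_of_eqOn_pos (macdonald_differentiableOn (by linarith) (by linarith))
    (macdonald_differentiableOn hν1 hν2.le) (fun _ hx => macdonald_neg_ofReal hν1 hν2 hx) hz

theorem besselKQuotient_half {z : ℂ} (hz : z ∈ Complex.slitPlane) :
    besselKQuotient (1 / 2) z =
      ((Real.pi : ℂ) / (2 * z)) ^ ((1 / 2 : ℝ) : ℂ) * Complex.exp (-z) := by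
  refine eqOn_slitPlane_of_eqOn_pos (besselKQuotient_differentiableOn (by norm_num) (by norm_num))
    (macdonald_prefactor_differentiableOn _) (fun x hx => ?_) hz
  have h2 : (Real.pi : ℂ) / (2 * (x : ℂ)) = ((Real.pi / (2 * x) : ℝ) : ℂ) := by push_cast; rfl
  have h3 : 0 ≤ Real.pi / (2 * x) := by positivity
  rw [besselKQuotient_half_ofReal hx, h2, ← Complex.ofReal_cpow h3, ← Real.sqrt_eq_rpow]
  push_cast
  rfl

/-! ### The order zero as a limit -/

theorem rpow_le_rpow_add_rpow {s a b c : ℝ} (hs : 0 < s) (hab : a ≤ b) (hbc : b ≤ c) :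
    s ^ b ≤ s ^ a + s ^ c := by
  have ha := Real.rpow_pos_of_pos hs a
  have hc := Real.rpow_pos_of_pos hs c
  rcases le_total s 1 with h | h
  · linarith [Real.rpow_le_rpow_of_exponent_ge hs h hab]
  · linarith [Real.rpow_le_rpow_of_exponent_le h hbc]

theorem macdonaldCore_tendsto_zero {ζ : ℂ} (hζ : ζ ∈ Complex.slitPlane) :
    Tendsto (fun μ => macdonaldCore μ ζ) (𝓝 0) (𝓝 (macdonaldCore 0 ζ)) := by
  obtain ⟨r, hr, m, hm, hm1, hb⟩ := Complex.exists_ball_le_norm_one_add_mul hζ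
  have hb' := (hb ζ (Metric.mem_ball_self hr)).2
  -- For `|μ| < 1/4` the exponent `μ - 1/2` lies between `-3/4` and `-1/4`; since `m ≤ 1`,
  -- `m^{μ-1/2}` is at most `m^{-1}`.
  refine tendsto_integral_filter_of_dominated_convergence
    (fun s => (s ^ (-3 / 4 : ℝ) * Real.exp (-(1 * s)) + s ^ (-1 / 4 : ℝ) * Real.exp (-(1 * s))) *
      m ^ (-1 : ℝ))
    (Eventually.of_forall fun μ => (macdonaldCore_integrand_measurable μ ζ).aestronglyMeasurable)
    ?_ ?_ ?_
  · filter_upwards [Ioo_mem_nhds (by norm_num : -(1 / 4 : ℝ) < 0) (by norm_num : (0 : ℝ) < 1 / 4)]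
      with μ hμ
    filter_upwards [self_mem_ae_restrict measurableSet_Ioi] with s hs
    have hs0 : 0 < s := hs
    obtain ⟨hμ1, hμ2⟩ := hμ
    rw [norm_mul, Complex.norm_real, Real.norm_of_nonneg (by positivity), one_mul,
      ← add_mul, mul_comm (Real.exp _)]
    gcongr
    · exact rpow_le_rpow_add_rpow hs0 (by linarith) (by linarith)
    · refine (norm_one_add_mul_cpow_le hm hs0.le (by linarith) (hb' s hs0.le)).trans ?_
      exact Real.rpow_le_rpow_of_exponent_ge hm hm1 (by linarith)
  · exact Integrable.mul_const ((integrableOn_rpow_mul_exp_neg (by norm_num) one_pos).add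
      (integrableOn_rpow_mul_exp_neg (by norm_num) one_pos)) _
  · filter_upwards [self_mem_ae_restrict measurableSet_Ioi] with s hs
    have hs0 : 0 < s := hs
    have hne : 1 + (s : ℂ) * ζ ≠ 0 :=
      Complex.slitPlane_ne_zero (Complex.one_add_ofReal_mul_mem_slitPlane hζ hs0.le)
    refine ContinuousAt.tendsto (x := (0 : ℝ)) (f := fun μ : ℝ =>
      ((Real.exp (-s) * s ^ (μ - 1 / 2) : ℝ) : ℂ) * (1 + s * ζ) ^ ((μ - 1 / 2 : ℝ) : ℂ)) ?_
    refine ContinuousAt.mul ?_ ?_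
    · refine Complex.continuous_ofReal.continuousAt.comp (ContinuousAt.mul (by fun_prop) ?_)
      exact ContinuousAt.rpow (by fun_prop) (by fun_prop) (Or.inl hs0.ne')
    · exact (continuousAt_const_cpow hne).comp
        (Complex.continuous_ofReal.continuousAt.comp (by fun_prop))

theorem macdonald_tendsto_zero {z : ℂ} (hz : z ∈ Complex.slitPlane) :
    Tendsto (fun μ => macdonald μ z) (𝓝 0) (𝓝 (macdonald 0 z)) := by
  refine Tendsto.mul (Tendsto.div tendsto_const_nhds ?_ ?_) (macdonaldCore_tendsto_zero
    (Complex.inv_mem_slitPlane_of_mem (two_mul_mem_slitPlane hz)))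
  · refine (Complex.continuous_ofReal.tendsto _).comp ?_
    have h1 : ContinuousAt Real.Gamma (0 + 1 / 2) :=
      (Real.differentiableAt_Gamma fun n => by
        have := n.cast_nonneg (α := ℝ); intro h; linarith).continuousAt
    exact ContinuousAt.tendsto (f := fun μ : ℝ => Real.Gamma (μ + 1 / 2)) (x := (0 : ℝ))
      (ContinuousAt.comp (f := fun μ : ℝ => μ + 1 / 2) h1 (by fun_prop))
  · exact Complex.ofReal_ne_zero.2 (Real.Gamma_pos_of_pos (by norm_num)).ne'

theorem besselK_eq_macdonald {ν : ℝ} (hν1 : -(1 / 2) < ν) (hν2 : ν < 1 / 2) {z : ℂ}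
    (hz : z ∈ Complex.slitPlane) : besselK ν z = macdonald ν z := by
  unfold besselK
  split_ifs with h
  · obtain ⟨n, rfl⟩ := h
    have h1 : (-1 : ℝ) < n := by linarith
    have h2 : (n : ℝ) < 1 := by linarith
    have hn : n = 0 := by
      have h1' : (-1 : ℤ) < n := by exact_mod_cast h1
      have h2' : n < (1 : ℤ) := by exact_mod_cast h2
      omega
    subst hn
    rw [Int.cast_zero]
    refine Tendsto.limUnder_eq (((macdonald_tendsto_zero hz).mono_left nhdsWithin_le_nhds).congr' ?_)
    filter_upwards [self_mem_nhdsWithin, nhdsWithin_le_nhds (Ioo_mem_nhds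
      (by norm_num : -(1 / 2 : ℝ) < 0) (by norm_num : (0 : ℝ) < 1 / 2))] with μ hμ0 hμ
    exact (besselKQuotient_eq_macdonald hμ.1 hμ.2 hμ0 hz).symm
  · refine besselKQuotient_eq_macdonald hν1 hν2 (fun h0 => h ⟨0, by simpa using h0⟩) hz

theorem besselK_half {ν : ℝ} (hν : ν = 1 / 2 ∨ ν = -(1 / 2)) {z : ℂ} (hz : z ∈ Complex.slitPlane) :
    besselK ν z = ((Real.pi : ℂ) / (2 * z)) ^ ((1 / 2 : ℝ) : ℂ) * Complex.exp (-z) := by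
  have hint : ¬ ∃ n : ℤ, ν = n := by
    rintro ⟨n, hn⟩
    have h2 : (2 : ℝ) * n = 1 ∨ (2 : ℝ) * n = -1 := by
      rcases hν with h | h
      · left; linarith
      · right; linarith
    have h3 : (2 : ℤ) * n = 1 ∨ (2 : ℤ) * n = -1 := by exact_mod_cast h2
    omega
  unfold besselK
  rw [if_neg hint, ← besselKQuotient_half hz]
  rcases hν with rfl | rfl
  · rfl
  · exact besselKQuotient_neg _ _

/-! ### The positive density and the rotation of the ray -/

/-- The Laplace density of `t ↦ e^{2t Re x} |K_ν(tx)|²`, up to a constant factor and a change of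
variables: `∫₀^∞ w^{ν-1/2} (1+w)^{-ν-1/2} (1+Dw)^{ν-1/2} dw`. -/
noncomputable def macdonaldDensity (ν D : ℝ) : ℝ :=
  ∫ w in Ioi (0 : ℝ), w ^ (ν - 1 / 2) * (1 + w * D) ^ (ν - 1 / 2) * (1 + w) ^ (-ν - 1 / 2)

theorem macdonaldDensity_pos {ν D : ℝ} (hν1 : -(1 / 2) < ν) (hν2 : ν < 1 / 2) (hD : 0 < D) :
    0 < macdonaldDensity ν D := by
  set c := min 1 D with hc
  have hc0 : 0 < c := lt_min one_pos hD
  -- Strict positivity requires integrability, the integral being `0` by convention otherwise. At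
  -- infinity the last two factors together decay like `(1 + w)^{-1}`.
  have hint : IntegrableOn (fun w : ℝ =>
      w ^ (ν - 1 / 2) * (1 + w * D) ^ (ν - 1 / 2) * (1 + w) ^ (-ν - 1 / 2)) (Ioi 0) := by
    refine Integrable.mono' ((integrableOn_rpow_mul_one_add_rpow (a := ν - 1 / 2) (b := -1)
      (by linarith) (by norm_num) (by linarith)).mul_const (c ^ (ν - 1 / 2)))
      (by fun_prop : Measurable fun w : ℝ => w ^ (ν - 1 / 2) * (1 + w * D) ^ (ν - 1 / 2) *
        (1 + w) ^ (-ν - 1 / 2)).aestronglyMeasurable ?_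
    filter_upwards [self_mem_ae_restrict measurableSet_Ioi] with w hw
    have hw0 : 0 < w := hw
    have h1 : c * (1 + w) ≤ 1 + w * D := by
      have := min_le_left 1 D
      have := min_le_right 1 D
      nlinarith
    rw [Real.norm_of_nonneg (by positivity)]
    have h2 : (1 + w * D) ^ (ν - 1 / 2) ≤ c ^ (ν - 1 / 2) * (1 + w) ^ (ν - 1 / 2) := by
      rw [← Real.mul_rpow hc0.le (by positivity)]
      exact Real.rpow_le_rpow_of_nonpos (by positivity) h1 (by linarith)
    calc w ^ (ν - 1 / 2) * (1 + w * D) ^ (ν - 1 / 2) * (1 + w) ^ (-ν - 1 / 2)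
        ≤ w ^ (ν - 1 / 2) * (c ^ (ν - 1 / 2) * (1 + w) ^ (ν - 1 / 2)) * (1 + w) ^ (-ν - 1 / 2) := by
          gcongr
      _ = w ^ (ν - 1 / 2) * ((1 + w) ^ (ν - 1 / 2) * (1 + w) ^ (-ν - 1 / 2)) * c ^ (ν - 1 / 2) := by
          ring
      _ = _ := by
          rw [← Real.rpow_add (by positivity), show ν - 1 / 2 + (-ν - 1 / 2) = -1 by ring]
  refine (setIntegral_pos_iff_support_of_nonneg_ae ?_ hint).2 ?_
  · filter_upwards [self_mem_ae_restrict (measurableSet_Ioi (a := (0 : ℝ)))] with w hw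
    have hw0 : 0 < w := hw
    simp only [Pi.zero_apply]
    positivity
  · have : Ioi (0 : ℝ) ⊆ (Function.support fun w : ℝ =>
        w ^ (ν - 1 / 2) * (1 + w * D) ^ (ν - 1 / 2) * (1 + w) ^ (-ν - 1 / 2)) ∩ Ioi 0 := by
      intro w hw
      refine ⟨?_, hw⟩
      have hw0 : 0 < w := hw
      rw [Function.mem_support]
      positivity
    refine lt_of_lt_of_le ?_ (measure_mono this)
    simp

/-- The integral obtained from `macdonaldDensity` by rotating the ray of integration. -/
noncomputable def rotatedDensity (ν D : ℝ) (q : ℂ) : ℂ :=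
  ∫ v in Ioi (0 : ℝ), ((v ^ (ν - 1 / 2) : ℝ) : ℂ) * (1 + v * (D / q)) ^ ((ν - 1 / 2 : ℝ) : ℂ) *
    (q + v) ^ ((-ν - 1 / 2 : ℝ) : ℂ)

/-- Under `v = xw` the powers of `x` cancel, the exponents `ν - 1/2` and `-ν - 1/2` adding up to
`-1` against the Jacobian. -/
theorem rotatedDensity_ofReal {ν D x : ℝ} (hD : 0 < D) (hx : 0 < x) :
    rotatedDensity ν D x = (macdonaldDensity ν D : ℂ) := by
  have hreal : rotatedDensity ν D x = ((∫ v in Ioi (0 : ℝ), v ^ (ν - 1 / 2) *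
      (1 + v * (D / x)) ^ (ν - 1 / 2) * (x + v) ^ (-ν - 1 / 2) : ℝ) : ℂ) := by
    unfold rotatedDensity
    rw [← integral_complex_ofReal]
    refine setIntegral_congr_fun measurableSet_Ioi fun v hv => ?_
    have hv0 : 0 < v := hv
    rw [Complex.ofReal_mul, Complex.ofReal_mul, Complex.ofReal_cpow (by positivity : 0 ≤ x + v),
      Complex.ofReal_cpow (by positivity : 0 ≤ 1 + v * (D / x))]
    push_cast
    rfl
  rw [hreal, Complex.ofReal_inj]
  have h := integral_comp_mul_left_Ioi (fun v : ℝ => v ^ (ν - 1 / 2) *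
      (1 + v * (D / x)) ^ (ν - 1 / 2) * (x + v) ^ (-ν - 1 / 2)) 0 hx
  rw [mul_zero] at h
  have h1 : ∀ w ∈ Ioi (0 : ℝ), (x * w) ^ (ν - 1 / 2) * (1 + x * w * (D / x)) ^ (ν - 1 / 2) *
      (x + x * w) ^ (-ν - 1 / 2) =
      x⁻¹ * (w ^ (ν - 1 / 2) * (1 + w * D) ^ (ν - 1 / 2) * (1 + w) ^ (-ν - 1 / 2)) := by
    intro w hw
    have hw0 : 0 < w := hw
    have e1 : x ^ (ν - 1 / 2) * x ^ (-ν - 1 / 2) = x⁻¹ := by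
      rw [← Real.rpow_add hx, show ν - 1 / 2 + (-ν - 1 / 2) = -1 by ring, Real.rpow_neg_one]
    rw [show x * w * (D / x) = w * D by field_simp, show x + x * w = x * (1 + w) by ring,
      Real.mul_rpow hx.le hw0.le, Real.mul_rpow hx.le (by positivity), ← e1]
    ring
  rw [setIntegral_congr_fun measurableSet_Ioi h1, integral_const_mul, smul_eq_mul] at h
  exact (mul_left_cancel₀ (inv_ne_zero hx.ne') h).symm

theorem div_mem_slitPlane {D : ℝ} (hD : 0 < D) {q : ℂ} (hq : q ∈ Complex.slitPlane) :
    D / q ∈ Complex.slitPlane := by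
  rw [div_eq_mul_inv]
  exact ofReal_mul_mem_slitPlane hD (Complex.inv_mem_slitPlane_of_mem hq)

theorem rotatedDensity_differentiableOn {ν D : ℝ} (hν1 : -(1 / 2) < ν) (hν2 : ν < 1 / 2)
    (hD : 0 < D) : DifferentiableOn ℂ (rotatedDensity ν D) Complex.slitPlane := by
  refine differentiableOn_integral_of_dominated (fun q _ => ?_) ?_ ?_
  · have h1 : Measurable fun v : ℝ => ((v ^ (ν - 1 / 2) : ℝ) : ℂ) := by fun_prop
    have h2 : Measurable fun v : ℝ => q + (v : ℂ) := by fun_prop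
    exact ((h1.mul (ofReal_cpow_measurable _ _)).mul (h2.pow_const _)).aestronglyMeasurable
  · filter_upwards [self_mem_ae_restrict measurableSet_Ioi] with v hv q hq
    have hv0 : 0 < v := hv
    refine DifferentiableAt.differentiableWithinAt (DifferentiableAt.mul ?_ ?_)
    · refine (DifferentiableAt.cpow ?_ (by fun_prop) ?_).const_mul _
      · exact ((DifferentiableAt.div (by fun_prop) (by fun_prop)
          (Complex.slitPlane_ne_zero hq)).const_mul _).const_add _
      · exact Complex.one_add_ofReal_mul_mem_slitPlane (div_mem_slitPlane hD hq) hv0.le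
    · exact DifferentiableAt.cpow (by fun_prop) (by fun_prop)
        (Complex.add_ofReal_mem_slitPlane hq hv0.le)
  · intro q₀ hq₀
    obtain ⟨r₁, hr₁, m₁, hm₁, -, hb₁⟩ :=
      Complex.exists_ball_le_norm_one_add_mul (div_mem_slitPlane hD hq₀)
    obtain ⟨r₂, hr₂, m₂, hm₂, -, hb₂⟩ := Complex.exists_ball_le_norm_add hq₀
    have hcont : ContinuousAt (fun q : ℂ => (D : ℂ) / q) q₀ :=
      ContinuousAt.div (by fun_prop) (by fun_prop) (Complex.slitPlane_ne_zero hq₀)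
    obtain ⟨r, hr, hb⟩ := Metric.eventually_nhds_iff_ball.1
      ((hcont.eventually (Metric.ball_mem_nhds _ hr₁)).and (Metric.ball_mem_nhds q₀ hr₂))
    refine ⟨r, hr, fun v => v ^ (ν - 1 / 2) * (1 + v) ^ (-1 : ℝ) *
      (m₁ ^ (ν - 1 / 2) * m₂ ^ (-ν - 1 / 2)),
      Integrable.mul_const (integrableOn_rpow_mul_one_add_rpow (by linarith) (by norm_num)
        (by linarith)) _, fun q hq => (hb₂ q (hb q hq).2).1, ?_⟩
    filter_upwards [self_mem_ae_restrict measurableSet_Ioi] with v hv q hq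
    have hv0 : 0 < v := hv
    have h1 := Complex.norm_cpow_ofReal_le (a := ν - 1 / 2) (by linarith)
      (by positivity : 0 < m₁ * (1 + v)) ((hb₁ _ (hb q hq).1).2 v hv0.le)
    have h2 := Complex.norm_cpow_ofReal_le (a := -ν - 1 / 2) (by linarith)
      (by positivity : 0 < m₂ * (1 + v)) ((hb₂ _ (hb q hq).2).2 v hv0.le)
    rw [Real.mul_rpow hm₁.le (by positivity)] at h1
    rw [Real.mul_rpow hm₂.le (by positivity)] at h2
    rw [norm_mul, norm_mul, Complex.norm_real, Real.norm_of_nonneg (by positivity)]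
    calc _ ≤ v ^ (ν - 1 / 2) * (m₁ ^ (ν - 1 / 2) * (1 + v) ^ (ν - 1 / 2)) *
          (m₂ ^ (-ν - 1 / 2) * (1 + v) ^ (-ν - 1 / 2)) := by gcongr
      _ = v ^ (ν - 1 / 2) * ((1 + v) ^ (ν - 1 / 2) * (1 + v) ^ (-ν - 1 / 2)) *
          (m₁ ^ (ν - 1 / 2) * m₂ ^ (-ν - 1 / 2)) := by ring
      _ = _ := by rw [← Real.rpow_add (by positivity), show ν - 1 / 2 + (-ν - 1 / 2) = -1 by ring]

/-- In place of a contour argument: with `D` fixed, the integral is holomorphic in `q` and constant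
on the positive reals, hence constant on the slit plane. -/
theorem rotatedDensity_eq {ν D : ℝ} (hν1 : -(1 / 2) < ν) (hν2 : ν < 1 / 2) (hD : 0 < D) {q : ℂ}
    (hq : q ∈ Complex.slitPlane) : rotatedDensity ν D q = (macdonaldDensity ν D : ℂ) :=
  eqOn_slitPlane_of_eqOn_pos (g := fun _ => (macdonaldDensity ν D : ℂ))
    (rotatedDensity_differentiableOn hν1 hν2 hD)
    (differentiableOn_const _) (fun _ hx => rotatedDensity_ofReal hD hx) hq

open ComplexConjugate in
theorem conj_mem_slitPlane {z : ℂ} (hz : z ∈ Complex.slitPlane) : conj z ∈ Complex.slitPlane := by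
  rcases hz with h | h
  · left; simpa using h
  · right; simpa using h

/-! ### Convolution of the two kernels -/

/-- The kernel `σ^{ν-1/2} (1 + σζ)^{ν-1/2}`. -/
noncomputable def macdonaldKernel (ν : ℝ) (ζ : ℂ) (σ : ℝ) : ℂ :=
  ((σ ^ (ν - 1 / 2) : ℝ) : ℂ) * (1 + σ * ζ) ^ ((ν - 1 / 2 : ℝ) : ℂ)

theorem image_mul_div_one_add {ρ : ℝ} (hρ : 0 < ρ) :
    (fun v : ℝ => ρ * v / (1 + v)) '' Ioi 0 = Ioo 0 ρ := by
  ext τ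
  constructor
  · rintro ⟨v, hv, rfl⟩
    have hv0 : 0 < v := hv
    refine ⟨by positivity, ?_⟩
    simp only
    rw [div_lt_iff₀ (by positivity)]
    nlinarith
  · rintro ⟨h0, h1⟩
    have h2 : 0 < ρ - τ := by linarith
    refine ⟨τ / (ρ - τ), div_pos h0 h2, ?_⟩
    simp only
    field_simp
    ring

open ComplexConjugate in
-- Put `τ = ρv/(1+v)`, `p = 1 + ρζ`, `q = conj p`. Then `1 + τζ = (1 + vp)/(1+v)` and `1 + (ρ-τ)
-- conj ζ = (q + v)/(1+v)`, and all powers of `ρ` and `1 + v` cancel. Since `p = |p|²/q`, the result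
-- is `rotatedDensity` with `D = |p|²`.
theorem macdonaldKernel_convolution {ν : ℝ} (hν1 : -(1 / 2) < ν) (hν2 : ν < 1 / 2) {ζ : ℂ}
    (hζ : ζ ∈ Complex.slitPlane) {ρ : ℝ} (hρ : 0 < ρ) :
    ∫ τ in (0 : ℝ)..ρ, macdonaldKernel ν ζ τ * macdonaldKernel (-ν) (conj ζ) (ρ - τ) =
      (macdonaldDensity ν (‖1 + ρ * ζ‖ ^ 2) : ℂ) := by
  set p : ℂ := 1 + ρ * ζ with hp
  set q : ℂ := 1 + ρ * conj ζ with hq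
  have hps : p ∈ Complex.slitPlane := Complex.one_add_ofReal_mul_mem_slitPlane hζ hρ.le
  have hqs : q ∈ Complex.slitPlane :=
    Complex.one_add_ofReal_mul_mem_slitPlane (conj_mem_slitPlane hζ) hρ.le
  have hp0 : p ≠ 0 := Complex.slitPlane_ne_zero hps
  have hq0 : q ≠ 0 := Complex.slitPlane_ne_zero hqs
  have hconj : conj p = q := by simp [hp, hq]
  have hpq : ((‖p‖ ^ 2 : ℝ) : ℂ) / q = p := by
    rw [div_eq_iff hq0, ← hconj, Complex.mul_conj, Complex.normSq_eq_norm_sq]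
  have hD : 0 < ‖p‖ ^ 2 := by positivity
  rw [← rotatedDensity_eq hν1 hν2 hD hqs]
  unfold rotatedDensity
  rw [hpq, intervalIntegral.integral_of_le hρ.le, integral_Ioc_eq_integral_Ioo,
    ← image_mul_div_one_add hρ]
  have hder : ∀ v ∈ Ioi (0 : ℝ), HasDerivWithinAt (fun v : ℝ => ρ * v / (1 + v))
      (ρ / (1 + v) ^ 2) (Ioi 0) v := by
    intro v hv
    have hv0 : 0 < v := hv
    have h := ((hasDerivAt_id v).const_mul ρ).div ((hasDerivAt_id v).const_add 1)
      (by simp only [id]; positivity)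
    refine HasDerivAt.hasDerivWithinAt ?_
    convert! h using 1
    simp only [id]
    ring
  have hinj : InjOn (fun v : ℝ => ρ * v / (1 + v)) (Ioi 0) := by
    intro v hv w hw h
    have hv0 : 0 < v := hv
    have hw0 : 0 < w := hw
    simp only at h
    rw [div_eq_div_iff (by positivity) (by positivity)] at h
    have h' : ρ * (v - w) = 0 := by linarith
    rcases mul_eq_zero.1 h' with h'' | h''
    · exact absurd h'' hρ.ne'
    · linarith
  rw [integral_image_eq_integral_abs_deriv_smul measurableSet_Ioi hder hinj]
  refine setIntegral_congr_fun measurableSet_Ioi fun v hv => ?_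
  have hv0 : 0 < v := hv
  have h1v : 0 < 1 + v := by positivity
  have hsub : ρ - ρ * v / (1 + v) = ρ * (1 + v)⁻¹ := by field_simp; ring
  have h1vc : (1 + v : ℂ) ≠ 0 := by
    have := Complex.ofReal_ne_zero.2 h1v.ne'
    simpa using this
  have e1 : (1 : ℂ) + ((ρ * v / (1 + v) : ℝ) : ℂ) * ζ = (((1 + v)⁻¹ : ℝ) : ℂ) * (1 + v * p) := by
    rw [hp]; push_cast; field_simp; ring
  have e2 : (1 : ℂ) + ((ρ * (1 + v)⁻¹ : ℝ) : ℂ) * conj ζ = (((1 + v)⁻¹ : ℝ) : ℂ) * (q + v) := by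
    rw [hq]; push_cast; field_simp; ring
  have n1 : 1 + v * p ≠ 0 :=
    Complex.slitPlane_ne_zero (Complex.one_add_ofReal_mul_mem_slitPlane hps hv0.le)
  have n2 : q + v ≠ 0 := Complex.slitPlane_ne_zero (Complex.add_ofReal_mem_slitPlane hqs hv0.le)
  unfold macdonaldKernel
  rw [hsub, e1, e2, Complex.ofReal_mul_cpow (by positivity) n1,
    Complex.ofReal_mul_cpow (by positivity) n2, ← Complex.ofReal_cpow (by positivity),
    ← Complex.ofReal_cpow (by positivity), abs_of_pos (by positivity), Complex.real_smul]
  have hscal : ρ / (1 + v) ^ 2 * (ρ * v / (1 + v)) ^ (ν - 1 / 2) * ((1 + v)⁻¹) ^ (ν - 1 / 2) *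
      (ρ * (1 + v)⁻¹) ^ (-ν - 1 / 2) * ((1 + v)⁻¹) ^ (-ν - 1 / 2) = v ^ (ν - 1 / 2) := by
    have a1 : ρ ^ (ν - 1 / 2) * ρ ^ (-ν - 1 / 2) = ρ⁻¹ := by
      rw [← Real.rpow_add hρ, show ν - 1 / 2 + (-ν - 1 / 2) = -1 by ring, Real.rpow_neg_one]
    have a2 : ((1 + v)⁻¹) ^ (ν - 1 / 2) * ((1 + v)⁻¹) ^ (-ν - 1 / 2) = 1 + v := by
      rw [← Real.rpow_add (by positivity), show ν - 1 / 2 + (-ν - 1 / 2) = -1 by ring,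
        Real.rpow_neg_one, inv_inv]
    rw [show ρ * v / (1 + v) = ρ * (v * (1 + v)⁻¹) by field_simp,
      Real.mul_rpow hρ.le (by positivity), Real.mul_rpow hv0.le (by positivity),
      Real.mul_rpow hρ.le (by positivity)]
    calc _ = ρ / (1 + v) ^ 2 * (ρ ^ (ν - 1 / 2) * ρ ^ (-ν - 1 / 2)) *
          (((1 + v)⁻¹) ^ (ν - 1 / 2) * ((1 + v)⁻¹) ^ (-ν - 1 / 2)) ^ 2 * v ^ (ν - 1 / 2) := by ring
      _ = v ^ (ν - 1 / 2) := by
          rw [a1, a2]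
          field_simp
  rw [← hscal]
  push_cast
  ring

theorem integrableOn_exp_mul_macdonaldKernel {ν : ℝ} (hν1 : -(1 / 2) < ν) (hν2 : ν ≤ 1 / 2) {ζ : ℂ}
    (hζ : ζ ∈ Complex.slitPlane) {t : ℝ} (ht : 0 < t) :
    IntegrableOn (fun σ : ℝ => (Real.exp (-(t * σ)) : ℂ) * macdonaldKernel ν ζ σ) (Ioi 0) := by
  obtain ⟨r, hr, m, hm, hm1, hb⟩ := Complex.exists_ball_le_norm_one_add_mul hζ
  have hb' := (hb ζ (Metric.mem_ball_self hr)).2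
  have hmeas : Measurable fun σ : ℝ => (Real.exp (-(t * σ)) : ℂ) * macdonaldKernel ν ζ σ := by
    have h1 : Measurable fun σ : ℝ => (Real.exp (-(t * σ)) : ℂ) := by fun_prop
    have h2 : Measurable fun σ : ℝ => ((σ ^ (ν - 1 / 2) : ℝ) : ℂ) := by fun_prop
    exact h1.mul (h2.mul (ofReal_cpow_measurable _ _))
  refine Integrable.mono' (Integrable.mul_const (integrableOn_rpow_mul_exp_neg
    (s := ν - 1 / 2) (by linarith) ht) (m ^ (ν - 1 / 2))) hmeas.aestronglyMeasurable ?_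
  filter_upwards [self_mem_ae_restrict measurableSet_Ioi] with s hs
  have hs0 : 0 < s := hs
  unfold macdonaldKernel
  rw [norm_mul, norm_mul, Complex.norm_real, Complex.norm_real,
    Real.norm_of_nonneg (by positivity), Real.norm_of_nonneg (by positivity),
    mul_comm (s ^ _) (Real.exp _), ← mul_assoc]
  gcongr
  exact norm_one_add_mul_cpow_le hm hs0.le (by linarith) (hb' s hs0.le)

/-- The scaling `s = tσ` confines the dependence on `t` to a power and the exponential, leaving a
Laplace transform in `t`. -/
theorem macdonaldCore_div {ν : ℝ} {ζ : ℂ} {t : ℝ} (ht : 0 < t) :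
    macdonaldCore ν (ζ / t) = ((t ^ (ν + 1 / 2) : ℝ) : ℂ) *
      ∫ σ in Ioi (0 : ℝ), (Real.exp (-(t * σ)) : ℂ) * macdonaldKernel ν ζ σ := by
  have h := integral_comp_mul_left_Ioi
    (fun s : ℝ => ((Real.exp (-s) * s ^ (ν - 1 / 2) : ℝ) : ℂ) *
      (1 + s * (ζ / t)) ^ ((ν - 1 / 2 : ℝ) : ℂ)) 0 ht
  rw [mul_zero] at h
  have htc : (t : ℂ) ≠ 0 := Complex.ofReal_ne_zero.2 ht.ne'
  have h1 : ∀ σ ∈ Ioi (0 : ℝ), ((Real.exp (-(t * σ)) * (t * σ) ^ (ν - 1 / 2) : ℝ) : ℂ) *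
      (1 + ((t * σ : ℝ) : ℂ) * (ζ / t)) ^ ((ν - 1 / 2 : ℝ) : ℂ) =
      ((t ^ (ν - 1 / 2) : ℝ) : ℂ) * ((Real.exp (-(t * σ)) : ℂ) * macdonaldKernel ν ζ σ) := by
    intro σ hσ
    have hσ0 : 0 < σ := hσ
    have e : ((t * σ : ℝ) : ℂ) * (ζ / t) = σ * ζ := by push_cast; field_simp
    rw [e, Real.mul_rpow ht.le hσ0.le]
    unfold macdonaldKernel
    push_cast
    ring
  rw [setIntegral_congr_fun measurableSet_Ioi h1, integral_const_mul] at h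
  unfold macdonaldCore
  have h2 : (t ^ (ν + 1 / 2) : ℝ) = t * t ^ (ν - 1 / 2) := by
    rw [mul_comm, ← Real.rpow_add_one ht.ne']; congr 1; ring
  rw [h2, Complex.ofReal_mul, mul_assoc, h, Complex.real_smul, Complex.ofReal_inv,
    mul_inv_cancel_left₀ htc]

open ComplexConjugate in
theorem exp_mul_kernel_convolution {ν : ℝ} (hν1 : -(1 / 2) < ν) (hν2 : ν < 1 / 2) {ζ : ℂ}
    (hζ : ζ ∈ Complex.slitPlane) (t : ℝ) {ρ : ℝ} (hρ : 0 < ρ) :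
    ∫ τ in (0 : ℝ)..ρ, ContinuousLinearMap.mul ℝ ℂ
      ((Real.exp (-(t * τ)) : ℂ) * macdonaldKernel ν ζ τ)
      ((Real.exp (-(t * (ρ - τ))) : ℂ) * macdonaldKernel (-ν) (conj ζ) (ρ - τ)) =
      ((Real.exp (-(t * ρ)) * macdonaldDensity ν (‖1 + ρ * ζ‖ ^ 2) : ℝ) : ℂ) := by
  rw [Complex.ofReal_mul, ← macdonaldKernel_convolution hν1 hν2 hζ hρ,
    ← intervalIntegral.integral_const_mul]
  refine intervalIntegral.integral_congr fun τ _ => ?_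
  have h : Real.exp (-(t * ρ)) = Real.exp (-(t * τ)) * Real.exp (-(t * (ρ - τ))) := by
    rw [← Real.exp_add]; ring_nf
  simp only [ContinuousLinearMap.mul_apply']
  rw [h]
  push_cast
  ring

open ComplexConjugate in
-- A product of Laplace transforms is the transform of the convolution; the opposite indices make
-- the two powers of `t` multiply to `t`.
theorem macdonaldCore_mul_conj {ν : ℝ} (hν1 : -(1 / 2) < ν) (hν2 : ν < 1 / 2) {ζ : ℂ}
    (hζ : ζ ∈ Complex.slitPlane) {t : ℝ} (ht : 0 < t) :
    macdonaldCore ν (ζ / t) * macdonaldCore (-ν) (conj ζ / t) = ((t * ∫ ρ in Ioi (0 : ℝ),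
      Real.exp (-(t * ρ)) * macdonaldDensity ν (‖1 + ρ * ζ‖ ^ 2) : ℝ) : ℂ) := by
  have h := integral_posConvolution
    (integrableOn_exp_mul_macdonaldKernel hν1 hν2.le hζ ht)
    (integrableOn_exp_mul_macdonaldKernel (ν := -ν) (by linarith) (by linarith)
      (conj_mem_slitPlane hζ) ht) (ContinuousLinearMap.mul ℝ ℂ)
  rw [setIntegral_congr_fun measurableSet_Ioi
    (fun ρ hρ => exp_mul_kernel_convolution hν1 hν2 hζ t hρ), integral_complex_ofReal,
    ContinuousLinearMap.mul_apply'] at h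
  rw [macdonaldCore_div ht, macdonaldCore_div ht, Complex.ofReal_mul, h]
  have h2 : (t : ℝ) = t ^ (ν + 1 / 2) * t ^ (-ν + 1 / 2) := by
    rw [← Real.rpow_add ht, show ν + 1 / 2 + (-ν + 1 / 2) = 1 by ring, Real.rpow_one]
  have h3 : (t : ℂ) = ((t ^ (ν + 1 / 2) : ℝ) : ℂ) * ((t ^ (-ν + 1 / 2) : ℝ) : ℂ) := by
    rw [← Complex.ofReal_mul, ← h2]
  conv_rhs => rw [h3]
  ring

theorem integrableOn_exp_mul_macdonaldDensity {ν : ℝ} (hν1 : -(1 / 2) < ν) (hν2 : ν < 1 / 2) {ζ : ℂ}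
    (hζ : ζ ∈ Complex.slitPlane) {t : ℝ} (ht : 0 < t) :
    IntegrableOn (fun ρ : ℝ => Real.exp (-(t * ρ)) * macdonaldDensity ν (‖1 + ρ * ζ‖ ^ 2))
      (Ioi 0) := by
  have h := (integrable_posConvolution
    (integrableOn_exp_mul_macdonaldKernel hν1 hν2.le hζ ht)
    (integrableOn_exp_mul_macdonaldKernel (ν := -ν) (by linarith) (by linarith)
      (conj_mem_slitPlane hζ) ht) (ContinuousLinearMap.mul ℝ ℂ)).integrableOn (s := Ioi 0)
  refine IntegrableOn.congr_fun (Integrable.re h) (fun ρ hρ => ?_) measurableSet_Ioi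
  rw [posConvolution, indicator_of_mem hρ, exp_mul_kernel_convolution hν1 hν2 hζ t hρ]
  rfl

/-! ### The squared modulus as a Laplace transform -/

open ComplexConjugate in
theorem conj_cpow_ofReal {z : ℂ} (hz : z ∈ Complex.slitPlane) (a : ℝ) :
    conj (z ^ (a : ℂ)) = (conj z) ^ (a : ℂ) := by
  rw [Complex.conj_cpow _ _ (Complex.mem_slitPlane_iff_arg.1 hz).1, Complex.conj_ofReal]

open ComplexConjugate in
theorem conj_macdonaldCore (ν : ℝ) {ζ : ℂ} (hζ : ζ ∈ Complex.slitPlane) :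
    conj (macdonaldCore ν ζ) = macdonaldCore ν (conj ζ) := by
  unfold macdonaldCore
  rw [← integral_conj]
  refine setIntegral_congr_fun measurableSet_Ioi fun s hs => ?_
  have hs0 : 0 < s := hs
  rw [map_mul, Complex.conj_ofReal,
    conj_cpow_ofReal (Complex.one_add_ofReal_mul_mem_slitPlane hζ hs0.le)]
  simp

theorem norm_sq_macdonald_prefactor (z : ℂ) :
    ‖((Real.pi : ℂ) / (2 * z)) ^ ((1 / 2 : ℝ) : ℂ) * Complex.exp (-z)‖ ^ 2 =
      Real.pi / (2 * ‖z‖) * Real.exp (-(2 * z.re)) := by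
  rw [norm_mul, mul_pow, Complex.norm_cpow_real, Complex.norm_exp, ← Real.sqrt_eq_rpow,
    Real.sq_sqrt (norm_nonneg _), norm_div, norm_mul, Complex.norm_real, Complex.norm_ofNat,
    Real.norm_of_nonneg Real.pi_pos.le, ← Real.exp_nat_mul]
  congr 2
  simp

open ComplexConjugate in
theorem norm_sq_macdonald {ν : ℝ} (hν1 : -(1 / 2) < ν) (hν2 : ν < 1 / 2) {x : ℂ}
    (hx : x ∈ Complex.slitPlane) {t : ℝ} (ht : 0 < t) :
    Real.exp (2 * t * x.re) * ‖macdonald ν (t * x)‖ ^ 2 =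
      ∫ ρ in Ioi (0 : ℝ), Real.exp (-(t * ρ)) * (Real.pi / (2 * ‖x‖) / (Real.Gamma (ν + 1 / 2) *
        Real.Gamma (-ν + 1 / 2)) * macdonaldDensity ν (‖1 + ρ * (2 * x)⁻¹‖ ^ 2)) := by
  have hz := ofReal_mul_mem_slitPlane ht hx
  have hζ := Complex.inv_mem_slitPlane_of_mem (two_mul_mem_slitPlane hx)
  have hζz := Complex.inv_mem_slitPlane_of_mem (two_mul_mem_slitPlane hz)
  have htc : (t : ℂ) ≠ 0 := Complex.ofReal_ne_zero.2 ht.ne'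
  have hxn : 0 < ‖x‖ := norm_pos_iff.2 (Complex.slitPlane_ne_zero hx)
  have hdiv : (2 * (t * x))⁻¹ = (2 * x)⁻¹ / t := by
    rw [mul_left_comm, mul_inv, div_eq_mul_inv, mul_comm]
  -- Evenness in the order puts `-ν` in the conjugated factor, so that `macdonaldCore_mul_conj`
  -- applies.
  have hnorm : ((‖macdonald ν (t * x)‖ ^ 2 : ℝ) : ℂ) =
      macdonald ν (t * x) * conj (macdonald (-ν) (t * x)) := by
    rw [macdonald_neg hν1 hν2 hz, Complex.mul_conj, Complex.normSq_eq_norm_sq]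
  set P : ℂ := ((Real.pi : ℂ) / (2 * (t * x))) ^ ((1 / 2 : ℝ) : ℂ) * Complex.exp (-(t * x)) with hP
  have hPn := norm_sq_macdonald_prefactor (t * x)
  rw [← hP] at hPn
  have hcore := macdonaldCore_mul_conj hν1 hν2 hζ ht
  set I : ℝ := ∫ ρ in Ioi (0 : ℝ),
    Real.exp (-(t * ρ)) * macdonaldDensity ν (‖1 + ρ * (2 * x)⁻¹‖ ^ 2) with hI
  have hmain : ‖macdonald ν (t * x)‖ ^ 2 =
      ‖P‖ ^ 2 / (Real.Gamma (ν + 1 / 2) * Real.Gamma (-ν + 1 / 2)) * (t * I) := by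
    rw [← Complex.ofReal_inj, hnorm]
    unfold macdonald
    rw [← hP, map_mul, map_div₀, Complex.conj_ofReal, conj_macdonaldCore _ hζz, hdiv, map_div₀,
      Complex.conj_ofReal, Complex.ofReal_mul _ (t * I), ← hcore, Complex.ofReal_div,
      ← Complex.normSq_eq_norm_sq, ← Complex.mul_conj]
    push_cast
    ring
  have hrhs : ∀ ρ : ℝ, Real.exp (-(t * ρ)) * (Real.pi / (2 * ‖x‖) / (Real.Gamma (ν + 1 / 2) *
        Real.Gamma (-ν + 1 / 2)) * macdonaldDensity ν (‖1 + ρ * (2 * x)⁻¹‖ ^ 2)) =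
      Real.pi / (2 * ‖x‖) / (Real.Gamma (ν + 1 / 2) * Real.Gamma (-ν + 1 / 2)) *
      (Real.exp (-(t * ρ)) * macdonaldDensity ν (‖1 + ρ * (2 * x)⁻¹‖ ^ 2)) := fun ρ => by ring
  simp_rw [hrhs]
  rw [integral_const_mul, ← hI, hmain, hPn, norm_mul, Complex.norm_real,
    Real.norm_of_nonneg ht.le, Complex.re_ofReal_mul, ← mul_assoc 2 t x.re]
  have hexp : Real.exp (2 * t * x.re) * Real.exp (-(2 * t * x.re)) = 1 := by
    rw [← Real.exp_add]; simp
  have hG1 : 0 < Real.Gamma (-ν + 1 / 2) := Real.Gamma_pos_of_pos (by linarith)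
  have hG2 : 0 < Real.Gamma (ν + 1 / 2) := Real.Gamma_pos_of_pos (by linarith)
  generalize Real.Gamma (-ν + 1 / 2) = g₁ at *
  generalize Real.Gamma (ν + 1 / 2) = g₂ at *
  calc _ = (Real.exp (2 * t * x.re) * Real.exp (-(2 * t * x.re))) *
        (Real.pi / (2 * (t * ‖x‖)) / (g₂ * g₁) * (t * I)) := by ring
    _ = _ := by
      rw [hexp]
      field_simp

theorem StrictlyCompletelyMonotone.congr {f g : ℝ → ℝ} (hf : StrictlyCompletelyMonotone f)
    (h : EqOn g f (Ioi 0)) : StrictlyCompletelyMonotone g := by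
  refine ⟨hf.1.congr h, fun n t ht => ?_⟩
  have hev : g =ᶠ[𝓝 t] f := h.eventuallyEq_of_mem (Ioi_mem_nhds ht)
  rw [hev.iteratedDeriv_eq n]
  exact hf.2 n t ht

theorem corollary3p7 (ν : ℝ) (hν₁ : -(1 / 2) ≤ ν) (hν₂ : ν ≤ 1 / 2)
    (x : ℂ) (hx : x ≠ 0) (harg : |Complex.arg x| < Real.pi) :
    StrictlyCompletelyMonotone
      (fun t : ℝ => Real.exp (2 * t * x.re) * ‖besselK ν ((t : ℂ) * x)‖ ^ 2) := by
  have hxs : x ∈ Complex.slitPlane :=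
    Complex.mem_slitPlane_iff_arg.2 ⟨((le_abs_self _).trans_lt harg).ne, hx⟩
  have hxn : 0 < ‖x‖ := norm_pos_iff.2 hx
  -- At the endpoints one of `Γ(±ν + 1/2)` sits at a pole, so the density formula breaks down; the
  -- closed form of `K_{±1/2}` gives a constant density instead.
  by_cases hhalf : ν = 1 / 2 ∨ ν = -(1 / 2)
  · refine (strictlyCompletelyMonotone_laplace (g := fun _ => Real.pi / (2 * ‖x‖))
      (fun _ _ => by positivity) (fun t ht => ?_)).congr fun t ht => ?_
    · simpa [IntegrableOn] using (integrableOn_rpow_mul_exp_neg (s := 0) (by norm_num) ht).mul_const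
        (Real.pi / (2 * ‖x‖))
    · have ht0 : 0 < t := ht
      simp only
      rw [besselK_half hhalf (ofReal_mul_mem_slitPlane ht0 hxs), norm_sq_macdonald_prefactor,
        norm_mul, Complex.norm_real, Real.norm_of_nonneg ht0.le, Complex.re_ofReal_mul,
        ← mul_assoc 2 t x.re, mul_left_comm, ← Real.exp_add, integral_mul_const]
      have h := Real.integral_rpow_mul_exp_neg_mul_Ioi one_pos ht0
      simp only [sub_self, Real.rpow_zero, one_mul, Real.rpow_one, Real.Gamma_one, mul_one] at h
      rw [h]
      simp only [add_neg_cancel, Real.exp_zero]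
      field_simp
  · rw [not_or] at hhalf
    have hν1 : -(1 / 2) < ν := lt_of_le_of_ne hν₁ (Ne.symm hhalf.2)
    have hν2 : ν < 1 / 2 := lt_of_le_of_ne hν₂ hhalf.1
    have hζ := Complex.inv_mem_slitPlane_of_mem (two_mul_mem_slitPlane hxs)
    have hG1 : 0 < Real.Gamma (-ν + 1 / 2) := Real.Gamma_pos_of_pos (by linarith)
    have hG2 : 0 < Real.Gamma (ν + 1 / 2) := Real.Gamma_pos_of_pos (by linarith)
    refine (strictlyCompletelyMonotone_laplace (g := fun ρ => Real.pi / (2 * ‖x‖) /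
      (Real.Gamma (ν + 1 / 2) * Real.Gamma (-ν + 1 / 2)) *
        macdonaldDensity ν (‖1 + ρ * (2 * x)⁻¹‖ ^ 2)) (fun ρ hρ => ?_) (fun t ht => ?_)).congr
      fun t ht => ?_
    · have h1 := Complex.slitPlane_ne_zero (Complex.one_add_ofReal_mul_mem_slitPlane hζ hρ.le)
      have h2 := macdonaldDensity_pos hν1 hν2 (pow_pos (norm_pos_iff.2 h1) 2)
      positivity
    · refine IntegrableOn.congr_fun ((integrableOn_exp_mul_macdonaldDensity hν1 hν2 hζ ht).const_mul
        (Real.pi / (2 * ‖x‖) / (Real.Gamma (ν + 1 / 2) * Real.Gamma (-ν + 1 / 2))))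
        (fun ρ _ => ?_) measurableSet_Ioi
      ring
    · simp only
      rw [besselK_eq_macdonald hν1 hν2 (ofReal_mul_mem_slitPlane ht hxs)]
      exact norm_sq_macdonald hν1 hν2 hxs ht
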